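/- All spaces are weak Hausdorff $k$-spaces, and products and quotients are taken in that category. A *flow* $X$ consists of a set $X^0$ of states, a space $\mathbb{P}_{\alpha,\beta}X$ of execution paths for all $\alpha,\beta\in X^0$, and continuous associative composition laws $*:\mathbb{P}_{\alpha,\beta}X\times\mathbb{P}_{\beta,\gamma}X\to\mathbb{P}_{\alpha,\gamma}X$; put $\mathbb{P}X=\bigsqcup_{\alpha,\beta}\mathbb{P}_{\alpha,\beta}X$. A morphism $f:X\to Y$ is a map $f^0:X^0\to Y^0$ with continuous maps $\mathbb{P}_{\alpha,\beta}X\to\mathbb{P}_{f^0(\alpha),f^0(\beta)}Y$ compatible with $*$. For a space $Z$, $\mathrm{Glob}(Z)$ is the flow with two states $\widehat 0,\widehat 1$, with $\mathbb{P}_{\widehat 0,\widehat 1}=Z$ and no other path. The *directed segment* is $\vec I=\mathrm{Glob}(\{u\})$. The tensor product has $(X\otimes Y)^0=X^0\times Y^0$ and $\mathbb{P}(X\otimes Y)=(\mathbb{P}X\times\mathbb{P}Y)\sqcup(X^0\times\mathbb{P}Y)\sqcup(\mathbb{P}X\times Y^0)$, with componentwise source, target and composition, states being treated as constant paths. Let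 $\mathrm{cell}(\mathrm{Flow})$ be the class of flows $X$ such that $\varnothing\to X$ is a transfinite composition of pushouts of the morphisms $\mathrm{Glob}(\mathbf S^{k-1})\subset\mathrm{Glob}(\mathbf D^k)$ ($k\ge 0$), $\{0,1\}\to\{0\}$ and $\varnothing\to\{0\}$ (sets being viewed as flows without paths). A morphism $f$ is a *weak S-homotopy equivalence* if $f^0$ is bijective and $\mathbb{P}f:\mathbb{P}X\to\mathbb{P}Y$ is a weak homotopy equivalence. It is an *S-homotopy equivalence* if there is a morphism $g:Y\to X$ such that $g f$ and $f g$ are S-homotopic to the identities, where two morphisms are S-homotopic if they are joined by a family $(H_t)_{t\in[0,1]}$ of morphisms of flows, constant on states and jointly continuous on $[0,1]\times\mathbb{P}$. A *full $n$-cube* $\vec C_n=Q(\vec I^{\otimes n})$ is a cofibrant replacement of $\vec I^{\otimes n}$, that is, an object of $\mathrm{cell}(\mathrm{Flow})$ with a weak S-homotopy equivalence to $\vec I^{\otimes n}$. For a state $\alpha$ of $Y$, let $\mathbb{P}^-_\alpha Y$ (resp. $\mathbb{P}^+_\alpha Y$) be the quotient of the space of paths starting from (resp. ending at) $\alpha$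 by the identifications $x=x*y$ (resp. $x=y*x$). A morphism $f:X\to Y$ between objects of $\mathrm{cell}(\mathrm{Flow})$ is a *T-homotopy equivalence* if (1) $f$ induces an isomorphism from $X$ to the restriction of $Y$ to the set of states $f^0(X^0)$; (2) for every $\alpha\in Y^0\setminus f^0(X^0)$, the spaces $\mathbb{P}^-_\alpha Y$ and $\mathbb{P}^+_\alpha Y$ are singletons; (3) for every $\alpha\in Y^0\setminus f^0(X^0)$ there are a path from a state of $f^0(X^0)$ to $\alpha$ and a path from $\alpha$ to a state of $f^0(X^0)$. **Theorem.** Let $n\ge 3$ and let $\vec C_n$ be a full $n$-cube. There do not exist an integer $m\ge 0$ and a zig-zag of morphisms of flows $$\vec C_n=X_0\xrightarrow{f_0}X_1\xleftarrow{f_1}X_2\xrightarrow{f_2}\cdots\xleftarrow{f_{2m-1}}X_{2m}=\vec I$$ in which every $X_i$ is an object of $\mathrm{cell}(\mathrm{Flow})$ and every $f_i$ is an S-homotopy equivalence or a T-homotopy equivalence. -/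

import Mathlib

open CategoryTheory

universe u

/-! ### Compactly generated spaces

Spaces are weak Hausdorff `k`-spaces. `CompactlyGeneratedSpace` is Mathlib's notion of a `k`-space:
the topology is the final one for all continuous maps from compact Hausdorff spaces. -/

/-- `X` is weak Hausdorff: the image of every continuous map from a compact Hausdorff space
to `X` is closed. -/
class WeaklyHausdorffSpace (X : Type u) [TopologicalSpace X] : Prop where
  isClosed_range : ∀ (K : Type u) [TopologicalSpace K] [CompactSpace K] [T2Space K] (f : K → X),
    Continuous f → IsClosed (Set.range f)

/-- The product in the category of compactly generated spaces: the set `A × B` with the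
`k`-ification of the product topology. -/
@[ext]
structure KProd (A B : Type u) : Type u where
  fst : A
  snd : B

instance (A B : Type u) [TopologicalSpace A] [TopologicalSpace B] :
    TopologicalSpace (KProd A B) :=
  (TopologicalSpace.compactlyGenerated.{u} (A × B)).coinduced fun p => ⟨p.1, p.2⟩

section Topology

variable {A B C D : Type u} [TopologicalSpace A] [TopologicalSpace B] [TopologicalSpace C]
  [TopologicalSpace D]

theorem WeaklyHausdorffSpace.of_t2 [T2Space A] : WeaklyHausdorffSpace A :=
  ⟨fun _ _ _ _ _ hf => (isCompact_range hf).isClosed⟩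

theorem KProd.continuous_of_compact {m : KProd A B → C}
    (h : ∀ (K : Type u) [TopologicalSpace K] [CompactSpace K] [T2Space K] (f : K → A) (g : K → B),
      Continuous f → Continuous g → Continuous (fun k => m ⟨f k, g k⟩)) : Continuous m := by
  refine continuous_coinduced_dom.2 ?_
  exact continuous_from_compactlyGenerated.{u} (X := A × B) _
    fun S g => h S (fun k => (g k).1) (fun k => (g k).2) (by fun_prop) (by fun_prop)

theorem KProd.continuous_mk {K : Type u} [TopologicalSpace K] [CompactlyGeneratedSpace K]
    {f : K → A} {g : K → B} (hf : Continuous f) (hg : Continuous g) :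
    Continuous (fun k => (⟨f k, g k⟩ : KProd A B)) := by
  refine continuous_from_uCompactlyGeneratedSpace.{u} _ fun S j => ?_
  have h0 : @Continuous _ _ inferInstance (TopologicalSpace.compactlyGenerated.{u} (A × B))
      (fun p : (Σ (i : (S : CompHaus.{u}) × C(S, A × B)), i.fst) => p.1.2 p.2) :=
    continuous_coinduced_rng
  have h1 : Continuous (fun p : (Σ (i : (S : CompHaus.{u}) × C(S, A × B)), i.fst) =>
      (⟨(p.1.2 p.2).1, (p.1.2 p.2).2⟩ : KProd A B)) :=
    continuous_iff_coinduced_le.2 (by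
      have := coinduced_mono (f := fun p : A × B => (⟨p.1, p.2⟩ : KProd A B))
        (continuous_iff_coinduced_le.1 h0)
      rwa [coinduced_compose] at this)
  exact h1.comp (continuous_sigmaMk (σ := fun i : (S : CompHaus.{u}) × C(S, A × B) => i.fst)
    (i := ⟨S, ⟨fun k => (f (j k), g (j k)), by fun_prop⟩⟩))

theorem KProd.continuous_fst : Continuous (fun p : KProd A B => p.fst) :=
  KProd.continuous_of_compact fun _ _ _ _ _ _ hf _ => hf

theorem KProd.continuous_snd : Continuous (fun p : KProd A B => p.snd) :=
  KProd.continuous_of_compact fun _ _ _ _ _ _ _ hg => hg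

instance : CompactlyGeneratedSpace (KProd A B) := by
  refine uCompactlyGeneratedSpace_of_continuous_maps.{u} fun {Y} _ m h => ?_
  refine KProd.continuous_of_compact fun K _ _ _ f g hf hg => ?_
  exact h (CompHaus.of K) ⟨fun k => ⟨f k, g k⟩, KProd.continuous_mk hf hg⟩

/-- In a weak Hausdorff space, the image of a compact Hausdorff space is Hausdorff. -/
theorem WeaklyHausdorffSpace.t2_range [WeaklyHausdorffSpace A] {K : Type u} [TopologicalSpace K]
    [CompactSpace K] [T2Space K] {f : K → A} (hf : Continuous f) : T2Space (Set.range f) := by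
  have hcl : ∀ s : Set K, IsClosed s → IsClosed (f '' s) := by
    intro s hs
    have : CompactSpace s := isCompact_iff_compactSpace.1 hs.isCompact
    have := WeaklyHausdorffSpace.isClosed_range (X := A) s (fun x => f x)
      (hf.comp continuous_subtype_val)
    rwa [Set.range_comp' f, Subtype.range_coe] at this
  have hpt : ∀ a : A, IsClosed (f ⁻¹' {a}) := by
    intro a
    by_cases h : a ∈ Set.range f
    · obtain ⟨k, rfl⟩ := h
      have := hcl {k} isClosed_singleton
      rw [Set.image_singleton] at this
      exact this.preimage hf
    · have : f ⁻¹' {a} = ∅ := by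
        ext k
        simp only [Set.mem_preimage, Set.mem_singleton_iff, Set.mem_empty_iff_false, iff_false]
        exact fun e => h ⟨k, e⟩
      rw [this]
      exact isClosed_empty
  refine ⟨fun x y hxy => ?_⟩
  have hd : Disjoint (f ⁻¹' {x.1}) (f ⁻¹' {y.1}) := by
    rw [Set.disjoint_left]
    intro k h1 h2
    exact hxy (Subtype.ext (h1.symm.trans h2))
  obtain ⟨U, V, hU, hV, hxU, hyV, hUV⟩ := normal_separation (hpt x.1) (hpt y.1) hd
  refine ⟨Subtype.val ⁻¹' (f '' Uᶜ)ᶜ, Subtype.val ⁻¹' (f '' Vᶜ)ᶜ,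
    (hcl _ hU.isClosed_compl).isOpen_compl.preimage continuous_subtype_val,
    (hcl _ hV.isClosed_compl).isOpen_compl.preimage continuous_subtype_val, ?_, ?_, ?_⟩
  · rintro ⟨k, hk, e⟩
    exact hk (hxU e)
  · rintro ⟨k, hk, e⟩
    exact hk (hyV e)
  · rw [Set.disjoint_left]
    rintro ⟨_, k, rfl⟩ h1 h2
    have h1' : k ∈ U := by
      by_contra h
      exact h1 ⟨k, h, rfl⟩
    have h2' : k ∈ V := by
      by_contra h
      exact h2 ⟨k, h, rfl⟩
    exact Set.disjoint_left.1 hUV h1' h2'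

instance [WeaklyHausdorffSpace A] [WeaklyHausdorffSpace B] :
    WeaklyHausdorffSpace (KProd A B) := by
  refine ⟨fun K _ _ _ f hf => ?_⟩
  have h1 : Continuous (fun k => (f k).fst) := KProd.continuous_fst.comp hf
  have h2 : Continuous (fun k => (f k).snd) := KProd.continuous_snd.comp hf
  have := WeaklyHausdorffSpace.t2_range h1
  have := WeaklyHausdorffSpace.t2_range h2
  have hc1 := WeaklyHausdorffSpace.isClosed_range K _ h1
  have hc2 := WeaklyHausdorffSpace.isClosed_range K _ h2
  let g : K → Set.range (fun k => (f k).fst) × Set.range (fun k => (f k).snd) :=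
    fun k => (⟨(f k).fst, k, rfl⟩, ⟨(f k).snd, k, rfl⟩)
  have hg : Continuous g := (h1.subtype_mk _).prodMk (h2.subtype_mk _)
  have hgc : IsClosed (Set.range g) := (isCompact_range hg).isClosed
  have he : Topology.IsClosedEmbedding
      (Prod.map Subtype.val Subtype.val :
        Set.range (fun k => (f k).fst) × Set.range (fun k => (f k).snd) → A × B) :=
    hc1.isClosedEmbedding_subtypeVal.prodMap hc2.isClosedEmbedding_subtypeVal
  have hfin := (he.isClosedMap _ hgc).preimage
    (KProd.continuous_fst.prodMk (KProd.continuous_snd (A := A) (B := B)))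
  convert hfin using 1
  ext p
  constructor
  · rintro ⟨k, rfl⟩
    exact ⟨g k, ⟨k, rfl⟩, rfl⟩
  · rintro ⟨_, ⟨k, rfl⟩, h⟩
    exact ⟨k, KProd.ext (congrArg Prod.fst h) (congrArg Prod.snd h)⟩

theorem WeaklyHausdorffSpace.of_isClopen_cover
    (h : ∀ a : A, ∃ (X : Type u) (_ : TopologicalSpace X) (_ : WeaklyHausdorffSpace X) (e : X → A),
      Topology.IsOpenEmbedding e ∧ IsClosed (Set.range e) ∧ a ∈ Set.range e) :
    WeaklyHausdorffSpace A := by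
  refine ⟨fun K _ _ _ f hf => ?_⟩
  rw [← isOpen_compl_iff, isOpen_iff_mem_nhds]
  intro a ha
  obtain ⟨X, _, _, e, he, hcl, x, rfl⟩ := h a
  let K' := f ⁻¹' Set.range e
  have : CompactSpace K' := isCompact_iff_compactSpace.1 (hcl.preimage hf).isCompact
  choose g hg using fun k : K' => k.2
  have hgc : Continuous g := by
    rw [he.isEmbedding.continuous_iff]
    have : e ∘ g = fun k : K' => f k := funext hg
    rw [this]
    exact hf.comp continuous_subtype_val
  have hcl := WeaklyHausdorffSpace.isClosed_range K' g hgc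
  have hx : x ∈ (Set.range g)ᶜ := by
    rintro ⟨k, rfl⟩
    exact ha ⟨k.1, (hg k).symm⟩
  refine Filter.mem_of_superset (he.isOpenMap.image_mem_nhds (hcl.isOpen_compl.mem_nhds hx)) ?_
  rintro _ ⟨y, hy, rfl⟩ ⟨k, hk⟩
  exact hy ⟨⟨k, ⟨y, hk.symm⟩⟩, he.injective ((hg _).trans hk)⟩

instance {p : Prop} {X : PLift p → Type u} [∀ i, TopologicalSpace (X i)]
    [∀ i, WeaklyHausdorffSpace (X i)] : WeaklyHausdorffSpace (Σ i, X i) :=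
  .of_isClopen_cover fun a => ⟨X a.1, inferInstance, inferInstance, Sigma.mk a.1,
    Topology.IsOpenEmbedding.sigmaMk, Topology.IsClosedEmbedding.sigmaMk.isClosed_range, a.2, rfl⟩

instance [WeaklyHausdorffSpace A] [WeaklyHausdorffSpace B] : WeaklyHausdorffSpace (A ⊕ B) :=
  .of_isClopen_cover fun x => match x with
    | .inl a => ⟨A, inferInstance, inferInstance, Sum.inl, Topology.IsOpenEmbedding.inl,
        isClosed_range_inl, a, rfl⟩
    | .inr b => ⟨B, inferInstance, inferInstance, Sum.inr, Topology.IsOpenEmbedding.inr,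
        isClosed_range_inr, b, rfl⟩

/-- `m` is continuous on the product of compactly generated spaces: it is continuous along every
pair of continuous maps from a compact Hausdorff space. -/
def KContinuous₂ (m : A → B → C) : Prop :=
  ∀ (K : Type u) [TopologicalSpace K] [CompactSpace K] [T2Space K] (f : K → A) (g : K → B),
    Continuous f → Continuous g → Continuous (fun k => m (f k) (g k))

theorem KContinuous₂.flip {m : A → B → C} (h : KContinuous₂ m) :
    KContinuous₂ (fun b a => m a b) :=
  fun K _ _ _ f g hf hg => h K g f hg hf

theorem KContinuous₂.continuous {m : A → B → C} (h : KContinuous₂ m) :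
    Continuous (fun p : KProd A B => m p.fst p.snd) :=
  KProd.continuous_of_compact h

theorem KContinuous₂.of_continuous {m : A → B → C}
    (h : Continuous (fun p : KProd A B => m p.fst p.snd)) : KContinuous₂ m :=
  fun _ _ _ _ _ _ hf hg => h.comp (KProd.continuous_mk hf hg)

theorem KContinuous₂.of_cover {m : A → B → C}
    (h : ∀ a : A, ∃ (X : Type u) (_ : TopologicalSpace X) (e : X → A),
      Topology.IsOpenEmbedding e ∧ IsClosed (Set.range e) ∧ a ∈ Set.range e ∧
        KContinuous₂ (fun x => m (e x))) : KContinuous₂ m := by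
  intro K _ _ _ f g hf hg
  rw [continuous_iff_continuousAt]
  intro k
  obtain ⟨X, _, e, he, hcl, hk, h⟩ := h (f k)
  let K' := f ⁻¹' Set.range e
  have : CompactSpace K' := isCompact_iff_compactSpace.1 (hcl.preimage hf).isCompact
  choose l hl using fun k : K' => k.2
  have hlc : Continuous l := by
    rw [he.isEmbedding.continuous_iff]
    have : e ∘ l = fun k : K' => f k := funext hl
    rw [this]
    exact hf.comp continuous_subtype_val
  have hc := h K' l (fun k => g k) hlc (hg.comp continuous_subtype_val)
  simp only [hl] at hc
  have hK' : IsOpen K' := he.isOpen_range.preimage hf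
  have hco : ContinuousOn (fun k => m (f k) (g k)) K' :=
    continuousOn_iff_continuous_domRestrict.2 hc
  exact hco.continuousAt (hK'.mem_nhds hk)

theorem KContinuous₂.sum {m : A ⊕ B → C → D} (h1 : KContinuous₂ (fun a => m (.inl a)))
    (h2 : KContinuous₂ (fun b => m (.inr b))) : KContinuous₂ m :=
  .of_cover fun x => match x with
    | .inl a => ⟨A, inferInstance, Sum.inl, Topology.IsOpenEmbedding.inl,
        isClosed_range_inl, ⟨a, rfl⟩, h1⟩
    | .inr b => ⟨B, inferInstance, Sum.inr, Topology.IsOpenEmbedding.inr,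
        isClosed_range_inr, ⟨b, rfl⟩, h2⟩

theorem KContinuous₂.sigma {p : Prop} {X : PLift p → Type u} [∀ i, TopologicalSpace (X i)]
    {m : (Σ i, X i) → C → D} (h : ∀ i, KContinuous₂ (fun x => m ⟨i, x⟩)) : KContinuous₂ m :=
  .of_cover fun a => ⟨X a.1, inferInstance, Sigma.mk a.1, Topology.IsOpenEmbedding.sigmaMk,
    Topology.IsClosedEmbedding.sigmaMk.isClosed_range, ⟨a.2, rfl⟩, h a.1⟩

end Topology

theorem continuous_of_isEmpty {A B : Type u} {_ : TopologicalSpace A} {_ : TopologicalSpace B}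
    (h : A → False) (f : A → B) : Continuous f :=
  continuous_iff_continuousAt.2 fun a => (h a).elim

/-! ### Flows -/

/-- A flow: a set of states, for each pair of states a compactly generated space of
(nonconstant) execution paths, and a continuous associative composition law. -/
structure PathFlow : Type (u + 1) where
  /-- the `0`-skeleton -/
  State : Type u
  /-- the execution paths from one state to another -/
  Path : State → State → Type u
  [top : ∀ a b, TopologicalSpace (Path a b)]
  [cg : ∀ a b, CompactlyGeneratedSpace (Path a b)]
  [wh : ∀ a b, WeaklyHausdorffSpace (Path a b)]
  /-- the composition law `x * y` -/
  comp : ∀ {a b c}, Path a b → Path b c → Path a c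
  continuous_comp : ∀ a b c, Continuous
    (fun p : KProd (Path a b) (Path b c) => comp p.fst p.snd)
  assoc : ∀ {a b c d} (x : Path a b) (y : Path b c) (z : Path c d),
    comp (comp x y) z = comp x (comp y z)

namespace PathFlow

attribute [instance] PathFlow.top PathFlow.cg PathFlow.wh

/-- A morphism of flows. -/
@[ext]
structure Hom (X Y : PathFlow.{u}) : Type u where
  state : X.State → Y.State
  path : ∀ {a b}, X.Path a b → Y.Path (state a) (state b)
  continuous_path : ∀ a b, Continuous (path : X.Path a b → Y.Path (state a) (state b))
  map_comp : ∀ {a b c} (x : X.Path a b) (y : X.Path b c),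
    path (X.comp x y) = Y.comp (path x) (path y)

instance : Category PathFlow.{u} where
  Hom := Hom
  id X := ⟨id, id, fun _ _ => continuous_id, fun _ _ => rfl⟩
  comp f g := ⟨g.state ∘ f.state, g.path ∘ f.path,
    fun _ _ => (g.continuous_path _ _).comp (f.continuous_path _ _),
    fun x y => by simp only [Function.comp_apply, f.map_comp, g.map_comp]⟩

/-- The path space `ℙX`: the disjoint union of all the spaces of paths. -/
abbrev PathSpace (X : PathFlow.{u}) : Type u := Σ p : X.State × X.State, X.Path p.1 p.2

/-- The continuous map `ℙf : ℙX → ℙY`. -/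
def Hom.onPaths {X Y : PathFlow.{u}} (f : X ⟶ Y) : C(X.PathSpace, Y.PathSpace) where
  toFun x := ⟨(Hom.state f x.1.1, Hom.state f x.1.2), Hom.path f x.2⟩
  continuous_toFun := continuous_sigma fun i => (continuous_sigmaMk
    (σ := fun p : Y.State × Y.State => Y.Path p.1 p.2)
    (i := (Hom.state f i.1, Hom.state f i.2))).comp (Hom.continuous_path f i.1 i.2)

/-- The set `S` viewed as a flow without execution paths. -/
def discrete (S : Type u) : PathFlow.{u} where
  State := S
  Path _ _ := PEmpty
  wh _ _ := .of_t2
  comp x _ := x.elim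
  continuous_comp _ _ _ := KProd.continuous_of_compact fun _ _ _ _ f _ _ _ =>
    continuous_iff_continuousAt.2 fun k => (f k).elim
  assoc x _ _ := x.elim

/-- A set map, viewed as a morphism of flows without execution paths. -/
def discreteMap {S T : Type u} (f : S → T) : discrete S ⟶ discrete T :=
  Hom.mk (X := discrete S) (Y := discrete T) f (fun x => x.elim)
    (fun _ _ => continuous_of_isEmpty (fun k => k.elim) _) (fun x _ => x.elim)

/-- The initial object: the flow without any state. -/
def empty : PathFlow.{u} := discrete PEmpty

/-- The unique morphism from the initial object. -/
def fromEmpty (X : PathFlow.{u}) : empty ⟶ X :=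
  Hom.mk (X := empty) (Y := X) PEmpty.elim (fun x => x.elim)
    (fun _ _ => continuous_of_isEmpty (fun k => k.elim) _) (fun x _ => x.elim)

/-! ### Globes -/

/-- The two states of a globe. -/
inductive GlobState : Type u
  | bot
  | top

/-- The execution paths of `Glob(Z)`: `Z` from the bottom state to the top one, and nothing else. -/
def GlobPath (Z : Type u) : GlobState.{u} → GlobState.{u} → Type u
  | .bot, .top => Z
  | .bot, .bot => PEmpty
  | .top, _ => PEmpty

instance (Z : Type u) [TopologicalSpace Z] : ∀ a b, TopologicalSpace (GlobPath Z a b)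
  | .bot, .top => inferInstanceAs (TopologicalSpace Z)
  | .bot, .bot => inferInstanceAs (TopologicalSpace PEmpty)
  | .top, _ => inferInstanceAs (TopologicalSpace PEmpty)

instance (Z : Type u) [TopologicalSpace Z] [CompactlyGeneratedSpace Z] :
    ∀ a b, CompactlyGeneratedSpace (GlobPath Z a b)
  | .bot, .top => inferInstanceAs (CompactlyGeneratedSpace Z)
  | .bot, .bot => inferInstanceAs (CompactlyGeneratedSpace PEmpty)
  | .top, _ => inferInstanceAs (CompactlyGeneratedSpace PEmpty)

instance (Z : Type u) [TopologicalSpace Z] [WeaklyHausdorffSpace Z] :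
    ∀ a b, WeaklyHausdorffSpace (GlobPath Z a b)
  | .bot, .top => inferInstanceAs (WeaklyHausdorffSpace Z)
  | .bot, .bot => WeaklyHausdorffSpace.of_t2 (A := PEmpty)
  | .top, _ => WeaklyHausdorffSpace.of_t2 (A := PEmpty)

theorem GlobPath.not_composable {Z : Type u} : ∀ {a b c : GlobState.{u}},
    GlobPath Z a b → GlobPath Z b c → False
  | .bot, .top, _, _, y => PEmpty.elim y
  | .bot, .bot, _, x, _ => PEmpty.elim x
  | .top, _, _, x, _ => PEmpty.elim x

/-- The globe `Glob(Z)`. No two of its execution paths are composable. -/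
def glob (Z : Type u) [TopologicalSpace Z] [CompactlyGeneratedSpace Z] [WeaklyHausdorffSpace Z] :
    PathFlow.{u} where
  State := GlobState
  Path := GlobPath Z
  comp x y := (GlobPath.not_composable x y).elim
  continuous_comp _ _ _ := KProd.continuous_of_compact fun _ _ _ _ f g _ _ =>
    continuous_iff_continuousAt.2 fun k => (GlobPath.not_composable (f k) (g k)).elim
  assoc x y _ := (GlobPath.not_composable x y).elim

/-- The action of `Glob` on the execution paths. -/
def GlobPath.map {Z W : Type u} (φ : Z → W) : ∀ {a b}, GlobPath Z a b → GlobPath W a b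
  | .bot, .top, z => φ z
  | .bot, .bot, x => PEmpty.elim x
  | .top, _, x => PEmpty.elim x

/-- The morphism `Glob(φ)`. -/
def globMap {Z W : Type u} [TopologicalSpace Z] [CompactlyGeneratedSpace Z]
    [WeaklyHausdorffSpace Z] [TopologicalSpace W] [CompactlyGeneratedSpace W]
    [WeaklyHausdorffSpace W] (φ : C(Z, W)) : glob Z ⟶ glob W :=
  Hom.mk (X := glob Z) (Y := glob W) id (fun x => GlobPath.map φ x)
    (fun a b => match a, b with
      | .bot, .top => φ.continuous
      | .bot, .bot => continuous_of_isEmpty (fun k => PEmpty.elim k) _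
      | .top, _ => continuous_of_isEmpty (fun k => PEmpty.elim k) _)
    (fun x y => (GlobPath.not_composable x y).elim)

/-- The directed segment. -/
def segment : PathFlow.{u} :=
  haveI : WeaklyHausdorffSpace PUnit.{u + 1} := .of_t2
  glob PUnit

/-! ### The tensor product -/

/-- The paths of `X ⊗ Y` from `(a, b)` to `(c, d)`: pairs of paths, pairs (constant path, path) and
pairs (path, constant path). -/
abbrev TensorPath (X Y : PathFlow.{u}) (a : X.State) (b : Y.State) (c : X.State) (d : Y.State) :
    Type u :=
  KProd (X.Path a c) (Y.Path b d) ⊕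
    ((Σ _ : PLift (a = c), Y.Path b d) ⊕ (Σ _ : PLift (b = d), X.Path a c))

/-- Componentwise composition, where constant paths are neutral. -/
def tensorComp (X Y : PathFlow.{u}) {a c e : X.State} {b d f : Y.State} :
    TensorPath X Y a b c d → TensorPath X Y c d e f → TensorPath X Y a b e f
  | .inl x, .inl y => .inl ⟨X.comp x.fst y.fst, Y.comp x.snd y.snd⟩
  | .inl x, .inr (.inl ⟨⟨h⟩, y⟩) => .inl ⟨h ▸ x.fst, Y.comp x.snd y⟩
  | .inl x, .inr (.inr ⟨⟨h⟩, y⟩) => .inl ⟨X.comp x.fst y, h ▸ x.snd⟩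
  | .inr (.inl ⟨⟨h⟩, x⟩), .inl y => .inl ⟨h ▸ y.fst, Y.comp x y.snd⟩
  | .inr (.inl ⟨⟨h⟩, x⟩), .inr (.inl ⟨⟨h₁⟩, y⟩) => .inr (.inl ⟨⟨h.trans h₁⟩, Y.comp x y⟩)
  | .inr (.inl ⟨⟨h⟩, x⟩), .inr (.inr ⟨⟨h₁⟩, y⟩) => .inl ⟨h ▸ y, h₁ ▸ x⟩
  | .inr (.inr ⟨⟨h⟩, x⟩), .inl y => .inl ⟨X.comp x y.fst, h ▸ y.snd⟩
  | .inr (.inr ⟨⟨h⟩, x⟩), .inr (.inl ⟨⟨h₁⟩, y⟩) => .inl ⟨h₁ ▸ x, h ▸ y⟩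
  | .inr (.inr ⟨⟨h⟩, x⟩), .inr (.inr ⟨⟨h₁⟩, y⟩) => .inr (.inr ⟨⟨h.trans h₁⟩, X.comp x y⟩)

theorem kContinuous_comp (X : PathFlow.{u}) (a b c : X.State) :
    KContinuous₂ (fun (x : X.Path a b) (y : X.Path b c) => X.comp x y) :=
  .of_continuous (X.continuous_comp a b c)

theorem kContinuous_tensorComp (X Y : PathFlow.{u}) (a c e : X.State) (b d f : Y.State) :
    KContinuous₂ (fun (x : TensorPath X Y a b c d) (y : TensorPath X Y c d e f) =>
      tensorComp X Y x y) := by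
  have hX := X.kContinuous_comp
  have hY := Y.kContinuous_comp
  have f1 {A B : Type u} [TopologicalSpace A] [TopologicalSpace B] {K : Type u}
    [TopologicalSpace K] {f : K → KProd A B} (hf : Continuous f) :
    Continuous fun k => (f k).fst := KProd.continuous_fst.comp hf
  have f2 {A B : Type u} [TopologicalSpace A] [TopologicalSpace B] {K : Type u}
    [TopologicalSpace K] {f : K → KProd A B} (hf : Continuous f) :
    Continuous fun k => (f k).snd := KProd.continuous_snd.comp hf
  refine .sum (KContinuous₂.flip (.sum ?_ (.sum (.sigma ?_) (.sigma ?_))))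
    (.sum (.sigma ?_) (.sigma ?_))
  · intro K _ _ _ f g hf hg
    exact continuous_inl.comp (KProd.continuous_mk (hX _ _ _ K _ _ (f1 hg) (f1 hf))
      (hY _ _ _ K _ _ (f2 hg) (f2 hf)))
  · rintro ⟨h⟩
    subst h
    intro K _ _ _ f g hf hg
    exact continuous_inl.comp (KProd.continuous_mk (f1 hg) (hY _ _ _ K _ _ (f2 hg) hf))
  · rintro ⟨h⟩
    subst h
    intro K _ _ _ f g hf hg
    exact continuous_inl.comp (KProd.continuous_mk (hX _ _ _ K _ _ (f1 hg) hf) (f2 hg))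
  · rintro ⟨h⟩
    subst h
    refine KContinuous₂.flip (.sum ?_ (.sum (.sigma ?_) (.sigma ?_)))
    · intro K _ _ _ f g hf hg
      exact continuous_inl.comp (KProd.continuous_mk (f1 hf) (hY _ _ _ K _ _ hg (f2 hf)))
    · rintro ⟨h⟩
      intro K _ _ _ f g hf hg
      exact continuous_inr.comp (continuous_inl.comp
        (continuous_sigmaMk.comp (hY _ _ _ K _ _ hg hf)))
    · rintro ⟨h⟩
      subst h
      intro K _ _ _ f g hf hg
      exact continuous_inl.comp (KProd.continuous_mk hf hg)
  · rintro ⟨h⟩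
    subst h
    refine KContinuous₂.flip (.sum ?_ (.sum (.sigma ?_) (.sigma ?_)))
    · intro K _ _ _ f g hf hg
      exact continuous_inl.comp (KProd.continuous_mk (hX _ _ _ K _ _ hg (f1 hf)) (f2 hf))
    · rintro ⟨h⟩
      subst h
      intro K _ _ _ f g hf hg
      exact continuous_inl.comp (KProd.continuous_mk hg hf)
    · rintro ⟨h⟩
      intro K _ _ _ f g hf hg
      exact continuous_inr.comp (continuous_inr.comp
        (continuous_sigmaMk.comp (hX _ _ _ K _ _ hg hf)))

theorem tensorComp_assoc (X Y : PathFlow.{u}) {a c e g : X.State} {b d f h : Y.State}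
    (x : TensorPath X Y a b c d) (y : TensorPath X Y c d e f) (z : TensorPath X Y e f g h) :
    tensorComp X Y (tensorComp X Y x y) z = tensorComp X Y x (tensorComp X Y y z) := by
  rcases x with x | ⟨⟨hx⟩, x⟩ | ⟨⟨hx⟩, x⟩ <;> rcases y with y | ⟨⟨hy⟩, y⟩ | ⟨⟨hy⟩, y⟩ <;>
    rcases z with z | ⟨⟨hz⟩, z⟩ | ⟨⟨hz⟩, z⟩ <;> subst_vars <;>
    simp only [tensorComp, X.assoc, Y.assoc]

/-- The tensor product of two flows. -/
def tensor (X Y : PathFlow.{u}) : PathFlow.{u} where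
  State := X.State × Y.State
  Path p q := TensorPath X Y p.1 p.2 q.1 q.2
  comp := tensorComp X Y
  continuous_comp p q r := (kContinuous_tensorComp X Y p.1 q.1 r.1 p.2 q.2 r.2).continuous
  assoc := tensorComp_assoc X Y

/-- The `n`-fold tensor power of the directed segment; for `n = 0` it is the unit of the tensor
product, the flow with one state and no execution path. -/
def segmentPow : ℕ → PathFlow.{u}
  | 0 => discrete PUnit
  | n + 1 => tensor (segmentPow n) segment

/-! ### Cell complexes -/

instance (n : ℕ) : T2Space (TopCat.disk.{u} n) :=
  inferInstanceAs (T2Space (ULift (Metric.closedBall (0 : EuclideanSpace ℝ (Fin n)) 1)))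

instance (n : ℕ) : T2Space (TopCat.diskBoundary.{u} n) :=
  inferInstanceAs (T2Space (ULift (Metric.sphere (0 : EuclideanSpace ℝ (Fin n)) 1)))

instance (n : ℕ) : WeaklyHausdorffSpace (TopCat.disk.{u} n) := .of_t2

instance (n : ℕ) : WeaklyHausdorffSpace (TopCat.diskBoundary.{u} n) := .of_t2

/-- The generating cofibrations: `Glob(Sⁿ⁻¹) ⊂ Glob(Dⁿ)` for `n ≥ 0`, `R : {0, 1} → {0}` and
`C : ∅ → {0}`. -/
inductive GeneratingCofibration : MorphismProperty PathFlow.{u}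
  | globe (n : ℕ) : GeneratingCofibration (globMap (TopCat.diskBoundaryInclusion.{u} n).hom)
  | collapse : GeneratingCofibration
      (discreteMap (fun _ => PUnit.unit : ULift.{u} Bool → PUnit.{u + 1}))
  | point : GeneratingCofibration (discreteMap (PEmpty.elim : PEmpty.{u + 1} → PUnit.{u + 1}))

/-- `X` is an object of `cell(Flow)`: the morphism `∅ ⟶ X` is a transfinite composition of pushouts
of generating cofibrations. -/
def IsCell (X : PathFlow.{u}) : Prop :=
  MorphismProperty.transfiniteCompositions.{u} GeneratingCofibration.pushouts (fromEmpty X)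

end PathFlow

/-! ### Weak homotopy equivalences -/

/-- The map induced by `f` on path components. -/
def ContinuousMap.onZerothHomotopy {A B : Type u} [TopologicalSpace A] [TopologicalSpace B]
    (f : C(A, B)) : ZerothHomotopy A → ZerothHomotopy B :=
  Quotient.map f fun _ _ h => h.map f.continuous

/-- The map induced by `f` on `πₙ`. -/
def ContinuousMap.onHomotopyGroup {A B : Type u} [TopologicalSpace A] [TopologicalSpace B]
    (f : C(A, B)) (n : ℕ) (a : A) : HomotopyGroup.Pi n A a → HomotopyGroup.Pi n B (f a) :=
  Quotient.map (fun p : GenLoop (Fin n) A a =>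
      (⟨f.comp p.1, fun y hy => congrArg f (p.2 y hy)⟩ : GenLoop (Fin n) B (f a)))
    fun _ _ h => ContinuousMap.HomotopicRel.comp_continuousMap h f

/-- `f` induces a bijection on path components and isomorphisms on all homotopy groups at all
base points. -/
def ContinuousMap.IsWeakHomotopyEquiv {A B : Type u} [TopologicalSpace A] [TopologicalSpace B]
    (f : C(A, B)) : Prop :=
  Function.Bijective f.onZerothHomotopy ∧
    ∀ (n : ℕ) (a : A), 1 ≤ n → Function.Bijective (f.onHomotopyGroup n a)

namespace PathFlow

/-! ### S-homotopy -/

/-- Weak S-homotopy equivalences. -/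
def IsWeakSHomotopyEquiv {X Y : PathFlow.{u}} (f : X ⟶ Y) : Prop :=
  Function.Bijective (Hom.state f) ∧ (Hom.onPaths f).IsWeakHomotopyEquiv

/-- `f` and `g` are S-homotopic: they are joined by a continuous family of morphisms of flows
(continuous on the discrete set of states means constant). -/
def SHomotopic {X Y : PathFlow.{u}} (f g : X ⟶ Y) : Prop :=
  ∃ H : unitInterval → (X ⟶ Y), H 0 = f ∧ H 1 = g ∧
    (∀ t a, Hom.state (H t) a = Hom.state f a) ∧
    Continuous (fun p : unitInterval × X.PathSpace => Hom.onPaths (H p.1) p.2)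

/-- S-homotopy equivalences. -/
def IsSHomotopyEquiv {X Y : PathFlow.{u}} (f : X ⟶ Y) : Prop :=
  ∃ g : Y ⟶ X, SHomotopic (f ≫ g) (𝟙 X) ∧ SHomotopic (g ≫ f) (𝟙 Y)

/-- `C` is a cofibrant replacement of `X` in `cell(Flow)`. -/
def IsCofibrantReplacement (C X : PathFlow.{u}) : Prop :=
  C.IsCell ∧ ∃ p : C ⟶ X, IsWeakSHomotopyEquiv p

/-! ### T-homotopy -/

/-- The restriction of the flow `X` to a set `A` of states. -/
def restrict (X : PathFlow.{u}) (A : Set X.State) : PathFlow.{u} where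
  State := A
  Path a b := X.Path a b
  comp := X.comp
  continuous_comp a b c := X.continuous_comp a b c
  assoc := X.assoc

/-- The morphism `f : X ⟶ Y`, seen as a morphism from `X` to the restriction of `Y` to `f(X⁰)`. -/
def Hom.toRestrict {X Y : PathFlow.{u}} (f : X ⟶ Y) : X ⟶ Y.restrict (Set.range (Hom.state f)) :=
  Hom.mk (X := X) (Y := Y.restrict (Set.range (Hom.state f))) (fun a => ⟨Hom.state f a, a, rfl⟩)
    (fun x => Hom.path f x) (fun a b => Hom.continuous_path f a b)
    (fun x y => Hom.map_comp f x y)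

/-- The smallest equivalence relation on the space of paths that start from `a` which identifies
`x` with `x * y` and whose quotient is weak Hausdorff. -/
def branchingSetoid (X : PathFlow.{u}) (a : X.State) : Setoid (Σ b, X.Path a b) :=
  sInf {r | (∀ (b c : X.State) (x : X.Path a b) (y : X.Path b c), r ⟨b, x⟩ ⟨c, X.comp x y⟩) ∧
    WeaklyHausdorffSpace (Quotient r)}

/-- The branching space at `a`: the quotient, in the category of compactly generated spaces,
of the space of paths that start from `a` by the identifications `x = x * y`. -/
abbrev BranchingSpace (X : PathFlow.{u}) (a : X.State) : Type u := Quotient (X.branchingSetoid a)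

/-- The smallest equivalence relation on the space of paths that end at `a` which identifies
`x` with `y * x` and whose quotient is weak Hausdorff. -/
def mergingSetoid (X : PathFlow.{u}) (a : X.State) : Setoid (Σ b, X.Path b a) :=
  sInf {r | (∀ (b c : X.State) (x : X.Path b a) (y : X.Path c b), r ⟨b, x⟩ ⟨c, X.comp y x⟩) ∧
    WeaklyHausdorffSpace (Quotient r)}

/-- The merging space at `a`: the quotient, in the category of compactly generated spaces,
of the space of paths that end at `a` by the identifications `x = y * x`. -/
abbrev MergingSpace (X : PathFlow.{u}) (a : X.State) : Type u := Quotient (X.mergingSetoid a)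

/-- `A` is surrounded by `B` in `X`. -/
def Surrounded (X : PathFlow.{u}) (A B : Set X.State) : Prop :=
  ∀ a ∈ A, a ∈ B ∨ ((∃ b ∈ B, Nonempty (X.Path b a)) ∧ ∃ c ∈ B, Nonempty (X.Path a c))

/-- T-homotopy equivalences (in the original sense). -/
structure IsTHomotopyEquiv {X Y : PathFlow.{u}} (f : X ⟶ Y) : Prop where
  isIso : IsIso (Hom.toRestrict f)
  branching : ∀ a ∉ Set.range (Hom.state f), Nonempty (Unique (Y.BranchingSpace a))
  merging : ∀ a ∉ Set.range (Hom.state f), Nonempty (Unique (Y.MergingSpace a))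
  surrounded : Y.Surrounded Set.univ (Set.range (Hom.state f))

end PathFlow

/-! The states of a full cube are the vertices of the cube, and one vertex reaches another exactly
when its support is strictly smaller. The invariant carried along the zig-zag is a core (`IsCore`):
a copy of this order among the states such that every other state has a least core state above it
and a greatest one below it. The cube is its own core; the segment has too few states to contain
one.

S-homotopy equivalences are bijective on states and preserve and reflect reachability, so cores pass
both ways. For a T-homotopy equivalence `X ⟶ Y`, all rests on `IsCofibrant.exists_successor`: in a
cofibrant flow, a state with a singleton branching space has a successor `b`, such that every path
from the state ends at `b` or at a state reachable from `b`. Iterating it, each new state of `Y`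
gets a least old state above it, so a core of `X` is sent to a core of `Y`. Conversely, a core state
of `Y` outside the image of `X` would have both a least core state strictly above it and a greatest
one strictly below it. For `3 ≤ n` this is impossible (`isRigid_segmentPow`), as each vertex has two
coordinates to raise or two to lower. Merging spaces are handled by reversing paths.

To find the successor, cofibrancy is used as a lifting property against flows whose paths are
families of real numbers. One lift yields an additive length. A second one adds nonzero weights on
states, those of `x * y` being those of `x`. Such weights are constant on a singleton branching
space, and they are bounded so that only states on the way to the end of a path can have positive
weight; a state of positive weight is therefore a successor. -/

namespace PathFlow

/-! ### Reversing the paths of a flow -/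

/-- The flow `X` with all its execution paths reversed. -/
def op (X : PathFlow.{u}) : PathFlow.{u} where
  State := X.State
  Path a b := X.Path b a
  comp x y := X.comp y x
  continuous_comp a b c := ((X.kContinuous_comp c b a).flip).continuous
  assoc x y z := (X.assoc z y x).symm

/-- The morphism `f` with all the execution paths reversed. -/
def Hom.op {X Y : PathFlow.{u}} (f : X ⟶ Y) : X.op ⟶ Y.op :=
  Hom.mk (X := X.op) (Y := Y.op) (Hom.state (X := X) (Y := Y) f)
    (fun x => Hom.path (X := X) (Y := Y) f x)
    (fun a b => Hom.continuous_path (X := X) (Y := Y) f b a)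
    (fun x y => Hom.map_comp (X := X) (Y := Y) f y x)

/-! ### Cofibrant flows -/

/-- Trivial fibrations: bijections on states which have the right lifting property with respect to
the inclusions of spheres into disks on each space of paths. -/
structure IsTrivialFibration {E D : PathFlow.{u}} (p : E ⟶ D) : Prop where
  bijective : Function.Bijective (Hom.state p)
  lift : ∀ (a b : E.State) (n : ℕ) (i : C(TopCat.diskBoundary.{u} n, E.Path a b))
    (j : C(TopCat.disk.{u} n, D.Path (Hom.state p a) (Hom.state p b))),
    (∀ s, Hom.path p (i s) = j ((TopCat.diskBoundaryInclusion.{u} n).hom s)) →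
    ∃ l : C(TopCat.disk.{u} n, E.Path a b),
      (∀ s, l ((TopCat.diskBoundaryInclusion.{u} n).hom s) = i s) ∧ ∀ x, Hom.path p (l x) = j x

theorem IsTrivialFibration.op {E D : PathFlow.{u}} {p : E ⟶ D} (hp : IsTrivialFibration p) :
    IsTrivialFibration (Hom.op p) :=
  ⟨hp.bijective, fun a b => hp.lift b a⟩

/-- Cofibrant flows: every morphism to the base of a trivial fibration lifts. -/
def IsCofibrant (Y : PathFlow.{u}) : Prop :=
  ∀ ⦃E D : PathFlow.{u}⦄ (p : E ⟶ D), IsTrivialFibration p → ∀ g : Y ⟶ D, ∃ l : Y ⟶ E, l ≫ p = g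

/-- Reversal is an involution that keeps trivial fibrations. Thus each result on branching spaces
also gives one on merging spaces. -/
theorem IsCofibrant.op {Y : PathFlow.{u}} (hY : Y.IsCofibrant) : Y.op.IsCofibrant := by
  intro E D p hp g
  obtain ⟨l, hl⟩ := hY (Hom.op p) hp.op (Hom.op g)
  exact ⟨Hom.op l, congrArg (fun k => Hom.op k) hl⟩

/-- The morphism from a globe given by a map to a space of paths. -/
def globDesc {Z : Type u} [TopologicalSpace Z] [CompactlyGeneratedSpace Z]
    [WeaklyHausdorffSpace Z] {X : PathFlow.{u}} (v : GlobState.{u} → X.State)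
    (φ : C(Z, X.Path (v .bot) (v .top))) : glob Z ⟶ X :=
  Hom.mk (X := glob Z) (Y := X) v
    (fun {a b} => match a, b with
      | .bot, .top => φ
      | .bot, .bot => fun x => PEmpty.elim x
      | .top, _ => fun x => PEmpty.elim x)
    (fun a b => match a, b with
      | .bot, .top => φ.continuous
      | .bot, .bot => continuous_of_isEmpty (fun k => PEmpty.elim k) _
      | .top, _ => continuous_of_isEmpty (fun k => PEmpty.elim k) _)
    (fun x y => (GlobPath.not_composable x y).elim)

/-- Both morphisms share the map `v` on states, which lets their paths be compared without
transport. -/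
theorem glob_hom_ext {Z : Type u} [TopologicalSpace Z] [CompactlyGeneratedSpace Z]
    [WeaklyHausdorffSpace Z] {X : PathFlow.{u}} (v : GlobState.{u} → X.State)
    {p q : ∀ {a b}, (glob Z).Path a b → X.Path (v a) (v b)} {hp hq hp' hq'}
    (h : ∀ z : Z, p (a := .bot) (b := .top) z = q (a := .bot) (b := .top) z) :
    (Hom.mk (X := glob Z) v p hp hp' : glob Z ⟶ X) = Hom.mk (X := glob Z) v q hq hq' := by
  have : @p = @q := by
    funext a b x
    match a, b, x with
    | .bot, .top, x => exact h x
    | .bot, .bot, x => exact PEmpty.elim x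
    | .top, _, x => exact PEmpty.elim x
  subst this
  rfl

theorem discrete_hom_ext {S : Type u} {X : PathFlow.{u}} {f g : discrete S ⟶ X}
    (h : Hom.state f = Hom.state g) : f = g := by
  obtain ⟨fs, fp, _, _⟩ := f
  obtain ⟨gs, gp, _, _⟩ := g
  obtain rfl : fs = gs := h
  have : @fp = @gp := by
    funext a b x
    exact PEmpty.elim x
  subst this
  rfl

/-- The morphism from a flow without paths given by a map on states. -/
def discreteDesc {S : Type u} {X : PathFlow.{u}} (v : S → X.State) : discrete S ⟶ X :=
  Hom.mk (X := discrete S) (Y := X) v (fun x => x.elim)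
    (fun _ _ => continuous_of_isEmpty (fun k => k.elim) _) (fun x _ => x.elim)

/-- Each kind of generator tests one clause: globes the lifting on path spaces, the collapse
injectivity on states, the point surjectivity on states. -/
theorem IsTrivialFibration.rlp {E D : PathFlow.{u}} {p : E ⟶ D} (hp : IsTrivialFibration p) :
    GeneratingCofibration.rlp p := by
  intro A B i hi
  refine ⟨fun {f g} sq => ?_⟩
  have hw := sq.w
  refine ⟨⟨?_⟩⟩
  -- The case split on the generator can only eliminate into a proposition, so mere existence of a
  -- lift is aimed at.
  apply Classical.choice
  cases hi with
  | globe n =>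
    obtain ⟨gs, gp, gc, gm⟩ := g
    obtain rfl : (fun a => Hom.state p (Hom.state f a)) = gs :=
      congrArg (fun k => Hom.state k) hw
    have hpath : ∀ s : TopCat.diskBoundary.{u} n,
        Hom.path p (Hom.path f (a := .bot) (b := .top) s) =
          gp (a := .bot) (b := .top) ((TopCat.diskBoundaryInclusion.{u} n).hom s) := by
      intro s
      have h1 := (Hom.mk.injEq _ _ _ _ _ _ _ _).mp hw
      have h2 := eq_of_heq h1.2
      exact congrFun (congrFun (congrFun h2 .bot) .top) s
    obtain ⟨l, hl1, hl2⟩ := hp.lift (Hom.state f .bot) (Hom.state f .top) n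
      ⟨fun s => Hom.path f (a := .bot) (b := .top) s, Hom.continuous_path f .bot .top⟩
      ⟨fun s => gp (a := .bot) (b := .top) s, gc .bot .top⟩ hpath
    refine ⟨⟨globDesc (Hom.state f) l, ?_, ?_⟩⟩
    · exact glob_hom_ext _ hl1
    · exact glob_hom_ext _ hl2
  | collapse =>
    have h : ∀ s, Hom.state f s = Hom.state f ⟨true⟩ := fun s => hp.bijective.1
      (congrFun (congrArg (fun k => Hom.state k) hw) s |>.trans
        (congrFun (congrArg (fun k => Hom.state k) hw) ⟨true⟩).symm)
    refine ⟨⟨discreteDesc fun _ => Hom.state f ⟨true⟩, discrete_hom_ext ?_,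
      discrete_hom_ext ?_⟩⟩
    · funext s
      exact (h s).symm
    · funext s
      exact congrFun (congrArg (fun k => Hom.state k) hw) ⟨true⟩
  | point =>
    obtain ⟨e, he⟩ := hp.bijective.2 (Hom.state g PUnit.unit)
    refine ⟨⟨discreteDesc fun _ => e, discrete_hom_ext ?_, discrete_hom_ext ?_⟩⟩
    · funext s
      exact PEmpty.elim s
    · funext s
      exact he

theorem IsCell.isCofibrant {Y : PathFlow.{u}} (hY : Y.IsCell) : Y.IsCofibrant := by
  intro E D p hp g
  have hG : GeneratingCofibration.{u}.pushouts.rlp p := by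
    rw [MorphismProperty.rlp_pushouts]
    exact hp.rlp
  have := MorphismProperty.transfiniteCompositions_le_llp_rlp.{u} _ _ hY p hG
  have sq : CommSq (fromEmpty E) (fromEmpty Y) p g :=
    ⟨discrete_hom_ext (S := PEmpty) (funext fun x => PEmpty.elim x)⟩
  exact ⟨sq.lift, sq.fac_right⟩

/-! ### Flows of real families -/

/-- A composition law for families of real numbers indexed by `J`, where the families which are
paths from one state to another are prescribed. -/
structure FamilyLaw (S J : Type u) where
  /-- the families which are paths from `a` to `b` -/
  carrier : S → S → Set (J → ℝ)
  /-- the composition law -/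
  mul : (J → ℝ) → (J → ℝ) → (J → ℝ)
  continuous_mul : Continuous fun p : (J → ℝ) × (J → ℝ) => mul p.1 p.2
  mul_assoc : ∀ q r s, mul (mul q r) s = mul q (mul r s)
  mul_mem : ∀ {a b c q r}, q ∈ carrier a b → r ∈ carrier b c → mul q r ∈ carrier a c

namespace FamilyLaw

variable {S I J : Type u}

/-- The flow of a composition law on families; the spaces of paths are the `k`-ifications of the
prescribed sets of families. -/
def flow (G : FamilyLaw S J) : PathFlow.{u} where
  State := S
  -- The product with a point in `k`-spaces is the `k`-ification.
  Path a b := KProd PUnit.{u + 1} (G.carrier a b)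
  wh a b := by
    have : WeaklyHausdorffSpace PUnit.{u + 1} := .of_t2
    have : WeaklyHausdorffSpace (G.carrier a b) := .of_t2
    infer_instance
  comp x y := ⟨PUnit.unit, ⟨G.mul x.snd.1 y.snd.1, G.mul_mem x.snd.2 y.snd.2⟩⟩
  continuous_comp a b c := KProd.continuous_of_compact fun K _ _ _ f g hf hg =>
    KProd.continuous_mk continuous_const <| Continuous.subtype_mk (G.continuous_mul.comp
      ((continuous_subtype_val.comp (KProd.continuous_snd.comp hf)).prodMk
        (continuous_subtype_val.comp (KProd.continuous_snd.comp hg)))) _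
  assoc x y z := by
    congr 2
    exact G.mul_assoc _ _ _

/-- A continuous multiplicative map from the paths of `Y` to the families of `G`. -/
structure Rep (Y : PathFlow.{u}) (G : FamilyLaw Y.State J) where
  toFun : ∀ {a b}, Y.Path a b → J → ℝ
  continuous_toFun : ∀ a b, Continuous (toFun : Y.Path a b → J → ℝ)
  mem : ∀ {a b} (x : Y.Path a b), toFun x ∈ G.carrier a b
  map_comp : ∀ {a b c} (x : Y.Path a b) (y : Y.Path b c),
    toFun (Y.comp x y) = G.mul (toFun x) (toFun y)

/-- The morphism of flows given by a multiplicative map. -/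
def Rep.hom {Y : PathFlow.{u}} {G : FamilyLaw Y.State J} (φ : Rep Y G) : Y ⟶ G.flow :=
  Hom.mk (X := Y) (Y := G.flow) id (fun x => ⟨PUnit.unit, ⟨φ.toFun x, φ.mem x⟩⟩)
    (fun a b => KProd.continuous_mk continuous_const ((φ.continuous_toFun a b).subtype_mk _))
    (fun x y => by
      change (⟨_, _⟩ : KProd _ _) = ⟨_, _⟩
      congr 2
      exact φ.map_comp x y)

/-- `r : I → J` restricts families of `E` to families of `D`, compatibly with the composition laws,
and families over a sphere lift along a family over a disk. -/
structure IsFibration (E : FamilyLaw S J) (D : FamilyLaw S I) (r : I → J) : Prop where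
  mem : ∀ {a b q}, q ∈ E.carrier a b → q ∘ r ∈ D.carrier a b
  mul : ∀ q s, E.mul q s ∘ r = D.mul (q ∘ r) (s ∘ r)
  lift : ∀ (a b : S) (n : ℕ) (f : TopCat.diskBoundary.{u} n → J → ℝ)
    (g : TopCat.disk.{u} n → I → ℝ), Continuous f → Continuous g → (∀ s, f s ∈ E.carrier a b) →
    (∀ x, g x ∈ D.carrier a b) →
    (∀ s, f s ∘ r = g ((TopCat.diskBoundaryInclusion.{u} n).hom s)) →
    ∃ l : TopCat.disk.{u} n → J → ℝ, Continuous l ∧ (∀ x, l x ∈ E.carrier a b) ∧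
      (∀ s, l ((TopCat.diskBoundaryInclusion.{u} n).hom s) = f s) ∧ ∀ x, l x ∘ r = g x

variable {E : FamilyLaw S J} {D : FamilyLaw S I} {r : I → J}

/-- The restriction of families, as a morphism of flows. -/
def IsFibration.hom (h : IsFibration E D r) : E.flow ⟶ D.flow :=
  Hom.mk (X := E.flow) (Y := D.flow) id (fun x => ⟨PUnit.unit, ⟨x.snd.1 ∘ r, h.mem x.snd.2⟩⟩)
    (fun a b => KProd.continuous_mk continuous_const (Continuous.subtype_mk
      ((continuous_pi fun i => continuous_apply (r i) : Continuous fun q : J → ℝ => q ∘ r).comp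
        (continuous_subtype_val.comp KProd.continuous_snd)) _))
    (fun x y => by
      change (⟨_, _⟩ : KProd _ _) = ⟨_, _⟩
      congr 2
      exact h.mul _ _)

/-- A disk is compactly generated, so a map that is continuous into a set of families stays
continuous into its `k`-ification. -/
theorem IsFibration.isTrivialFibration (h : IsFibration E D r) : IsTrivialFibration h.hom := by
  refine ⟨Function.bijective_id, fun a b n i j hij => ?_⟩
  obtain ⟨l, hl, hm, h1, h2⟩ := h.lift a b n (fun s => (i s).snd.1) (fun x => (j x).snd.1)
    (continuous_subtype_val.comp (KProd.continuous_snd.comp i.continuous))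
    (continuous_subtype_val.comp (KProd.continuous_snd.comp j.continuous))
    (fun s => (i s).snd.2) (fun x => (j x).snd.2)
    (fun s => congrArg (fun k : KProd PUnit (D.carrier a b) => k.snd.1) (hij s))
  refine ⟨⟨fun x => ⟨PUnit.unit, ⟨l x, hm x⟩⟩,
    KProd.continuous_mk continuous_const (hl.subtype_mk _)⟩, fun s => ?_, fun x => ?_⟩
  · exact KProd.ext rfl (Subtype.ext (h1 s))
  · exact KProd.ext rfl (Subtype.ext (h2 x))

theorem IsFibration.exists_lift {Y : PathFlow.{u}} (hY : Y.IsCofibrant) {E : FamilyLaw Y.State J}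
    {D : FamilyLaw Y.State I} {r : I → J} (h : IsFibration E D r) (φ : Rep Y D) :
    ∃ ψ : Rep Y E, ∀ {a b} (x : Y.Path a b), ψ.toFun x ∘ r = φ.toFun x := by
  obtain ⟨⟨ls, lp, lc, lm⟩, hl⟩ := hY h.hom h.isTrivialFibration φ.hom
  -- The projection is the identity on states, hence so is the lift, which is therefore again a
  -- multiplicative map on the paths of `Y`.
  obtain rfl : ls = id := congrArg (fun k => Hom.state k) hl
  refine ⟨⟨fun x => (lp x).snd.1, fun a b => continuous_subtype_val.comp
    (KProd.continuous_snd.comp (lc a b)), fun x => (lp x).snd.2, fun x y => ?_⟩, fun {a b} x => ?_⟩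
  · exact congrArg (fun k : KProd PUnit (E.carrier _ _) => k.snd.1) (lm x y)
  · have h2 := eq_of_heq ((Hom.mk.injEq _ _ _ _ _ _ _ _).mp hl).2
    exact congrArg (fun k : KProd PUnit (D.carrier a b) => k.snd.1)
      (congrFun (congrFun (congrFun h2 a) b) x)

end FamilyLaw

/-! ### Length functions -/

theorem isClosedEmbedding_diskBoundaryInclusion (n : ℕ) :
    Topology.IsClosedEmbedding (TopCat.diskBoundaryInclusion.{u} n).hom :=
  (TopCat.diskBoundaryInclusion.{u} n).hom.continuous.isClosedEmbedding
    ((TopCat.mono_iff_injective _).1 inferInstance)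

theorem exists_extension_disk (n : ℕ) {f : TopCat.diskBoundary.{u} n → ℝ} (hf : Continuous f) :
    ∃ g : TopCat.disk.{u} n → ℝ, Continuous g ∧
      ∀ s, g ((TopCat.diskBoundaryInclusion.{u} n).hom s) = f s := by
  obtain ⟨g, hg⟩ := ContinuousMap.exists_extension'
    (isClosedEmbedding_diskBoundaryInclusion.{u} n) ⟨f, hf⟩
  exact ⟨g, g.continuous, congrFun hg⟩

/-- A continuous additive function on the paths of `Y` with values at least `2`. -/
structure Length (Y : PathFlow.{u}) where
  toFun : ∀ {a b}, Y.Path a b → ℝ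
  continuous_toFun : ∀ a b, Continuous (toFun : Y.Path a b → ℝ)
  two_le : ∀ {a b} (x : Y.Path a b), 2 ≤ toFun x
  map_comp : ∀ {a b c} (x : Y.Path a b) (y : Y.Path b c), toFun (Y.comp x y) = toFun x + toFun y

/-- Addition of real numbers that are at least `2`. -/
def addLaw (S : Type u) : FamilyLaw S PUnit.{u + 1} where
  carrier _ _ := {q | 2 ≤ q PUnit.unit}
  mul q r := q + r
  continuous_mul := continuous_fst.add continuous_snd
  mul_assoc := add_assoc
  mul_mem {_ _ _ q r} hq hr := by
    simp only [Set.mem_ofPred_eq, Pi.add_apply] at *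
    linarith

/-- The law with one path between any two states. -/
def trivialLaw (S : Type u) : FamilyLaw S PEmpty.{u + 1} where
  carrier _ _ := Set.univ
  mul q _ := q
  continuous_mul := continuous_fst
  mul_assoc _ _ _ := rfl
  mul_mem _ _ := trivial

/-- The half-line of reals at least `2` is a retract of the line: extend by Tietze, then clip from
below. -/
theorem isFibration_addLaw (S : Type u) :
    FamilyLaw.IsFibration (addLaw S) (trivialLaw S) PEmpty.elim where
  mem _ := trivial
  mul _ _ := Subsingleton.elim _ _
  lift a b n f g hf _ hmem _ _ := by
    obtain ⟨l, hl, hlf⟩ := exists_extension_disk n ((continuous_apply PUnit.unit).comp hf)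
    refine ⟨fun x _ => max 2 (l x), continuous_pi fun _ => continuous_const.max hl,
      fun x => le_max_left (2 : ℝ) (l x), fun s => funext fun i => ?_, fun x => Subsingleton.elim _ _⟩
    change max 2 (l _) = f s i
    rw [hlf]
    exact max_eq_right (hmem s)

theorem IsCofibrant.nonempty_length {Y : PathFlow.{u}} (hY : Y.IsCofibrant) :
    Nonempty Y.Length := by
  obtain ⟨ψ, -⟩ := (isFibration_addLaw Y.State).exists_lift hY
    ⟨fun _ i => i.elim, fun _ _ => continuous_pi fun i => i.elim, fun _ => trivial,
      fun _ _ => Subsingleton.elim _ _⟩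
  exact ⟨⟨fun x => ψ.toFun x PUnit.unit, fun a b => (continuous_apply _).comp
    (ψ.continuous_toFun a b), fun x => ψ.mem x, fun x y => congrFun (ψ.map_comp x y) PUnit.unit⟩⟩

/-- There is an execution path from `a` to `b`. -/
def Reaches (X : PathFlow.{u}) (a b : X.State) : Prop := Nonempty (X.Path a b)

theorem Reaches.trans {X : PathFlow.{u}} {a b c : X.State} (h : X.Reaches a b)
    (h' : X.Reaches b c) : X.Reaches a c :=
  ⟨X.comp h.some h'.some⟩

namespace Length

variable {Y : PathFlow.{u}} (ℓ : Y.Length)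

/-- The infimum of the lengths of the paths from `a` to `b`. -/
noncomputable def dist (a b : Y.State) : ℝ := sInf (Set.range (ℓ.toFun : Y.Path a b → ℝ))

theorem bddBelow (a b : Y.State) : BddBelow (Set.range (ℓ.toFun : Y.Path a b → ℝ)) :=
  ⟨2, by rintro _ ⟨x, rfl⟩; exact ℓ.two_le x⟩

theorem dist_le {a b : Y.State} (x : Y.Path a b) : ℓ.dist a b ≤ ℓ.toFun x :=
  csInf_le (ℓ.bddBelow a b) ⟨x, rfl⟩

theorem exists_lt_of_dist_lt {a b : Y.State} (h : Y.Reaches a b) {L : ℝ} (hL : ℓ.dist a b < L) :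
    ∃ x : Y.Path a b, ℓ.toFun x < L := by
  obtain ⟨x⟩ := h
  obtain ⟨_, ⟨z, rfl⟩, hz⟩ := exists_lt_of_csInf_lt (Set.range_nonempty_iff_nonempty.2 ⟨x⟩) hL
  exact ⟨z, hz⟩

theorem two_le_dist {a b : Y.State} (h : Y.Reaches a b) : 2 ≤ ℓ.dist a b := by
  obtain ⟨x⟩ := h
  exact le_csInf ⟨_, x, rfl⟩ (by rintro _ ⟨x, rfl⟩; exact ℓ.two_le x)

theorem dist_triangle {a b c : Y.State} (h : Y.Reaches a b) (h' : Y.Reaches b c) :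
    ℓ.dist a c ≤ ℓ.dist a b + ℓ.dist b c := by
  refine le_of_forall_pos_le_add fun ε hε => ?_
  obtain ⟨x, hx⟩ := ℓ.exists_lt_of_dist_lt h (lt_add_of_pos_right _ (half_pos hε))
  obtain ⟨y, hy⟩ := ℓ.exists_lt_of_dist_lt h' (lt_add_of_pos_right _ (half_pos hε))
  have := ℓ.dist_le (Y.comp x y)
  rw [ℓ.map_comp] at this
  linarith

/-- Addition of the real numbers that are at least the distance between two states. -/
def lengthLaw : FamilyLaw Y.State PUnit.{u + 1} where
  carrier a b := {q | Y.Reaches a b ∧ ℓ.dist a b ≤ q PUnit.unit}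
  mul q r := q + r
  continuous_mul := continuous_fst.add continuous_snd
  mul_assoc := add_assoc
  mul_mem hq hr :=
    ⟨hq.1.trans hr.1, (ℓ.dist_triangle hq.1 hr.1).trans (add_le_add hq.2 hr.2)⟩

/-- The length function, with values in the flow of lengths. -/
def rep : FamilyLaw.Rep Y ℓ.lengthLaw where
  toFun x _ := ℓ.toFun x
  continuous_toFun a b := continuous_pi fun _ => ℓ.continuous_toFun a b
  mem x := ⟨⟨x⟩, ℓ.dist_le x⟩
  map_comp x y := funext fun _ => ℓ.map_comp x y

/-! ### Bounded weights on states -/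

open Classical in
/-- The bound on the weight that a path from `a` to `b` of length `L` may give to the state `c`.
It is positive for `c = b`, and for the states `c` on the way to `b` from which `b` is reached by
a path shorter than `L - 1`. -/
noncomputable def weightBound (a b c : Y.State) (L : ℝ) : ℝ :=
  if c = b then 1 else
    if Y.Reaches a c ∧ Y.Reaches c b then min 1 (max 0 (L - 1 - ℓ.dist c b)) else 0

theorem continuous_weightBound (a b c : Y.State) : Continuous (ℓ.weightBound a b c) := by
  unfold weightBound
  split_ifs <;> fun_prop

theorem weightBound_nonneg (a b c : Y.State) (L : ℝ) : 0 ≤ ℓ.weightBound a b c L := by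
  unfold weightBound
  split_ifs <;> positivity

theorem weightBound_le_one (a b c : Y.State) (L : ℝ) : ℓ.weightBound a b c L ≤ 1 := by
  unfold weightBound
  split_ifs <;> simp

theorem weightBound_self (a b : Y.State) (L : ℝ) : ℓ.weightBound a b b L = 1 := by
  simp [weightBound]

/-- The distance is an infimum that need not be attained; a strict inequality is what produces an
actual path. -/
theorem weightBound_pos {a b c : Y.State} {L : ℝ} (h : 0 < ℓ.weightBound a b c L) :
    c = b ∨ Y.Reaches a c ∧ ∃ z : Y.Path c b, ℓ.toFun z < L - 1 := by
  unfold weightBound at h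
  split_ifs at h with h1 h2
  · exact .inl h1
  · refine .inr ⟨h2.1, ℓ.exists_lt_of_dist_lt h2.2 ?_⟩
    rcases lt_max_iff.1 (lt_min_iff.1 h).2 with h | h
    · exact absurd h (lt_irrefl _)
    · linarith
  · exact absurd h (lt_irrefl _)

/-- This is what allows a composite to inherit the weights of its first factor. -/
theorem weightBound_le_add {a b e : Y.State} (c : Y.State) {L M : ℝ} (hab : Y.Reaches a b)
    (hbe : Y.Reaches b e) (hL : ℓ.dist a b ≤ L) (hM : ℓ.dist b e ≤ M) :
    ℓ.weightBound a b c L ≤ ℓ.weightBound a e c (L + M) := by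
  by_cases hce : c = e
  · subst hce
    rw [weightBound_self]
    exact ℓ.weightBound_le_one _ _ _ _
  by_cases hcb : c = b
  · subst hcb
    have := ℓ.two_le_dist hab
    rw [weightBound_self, weightBound, if_neg hce, if_pos ⟨hab, hbe⟩]
    -- The minimal length `2` matters here: `L ≥ 2` and `M ≥ ℓ.dist b e` give `L + M - 1 - ℓ.dist b
    -- e ≥ 1`, so the former endpoint keeps the full bound `1`.
    exact le_min le_rfl (le_max_of_le_right (by linarith))
  by_cases h : Y.Reaches a c ∧ Y.Reaches c b
  · have := ℓ.dist_triangle h.2 hbe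
    rw [weightBound, if_neg hcb, if_pos h, weightBound, if_neg hce,
      if_pos ⟨h.1, h.2.trans hbe⟩]
    exact min_le_min le_rfl (max_le_max le_rfl (by linarith))
  · rw [weightBound, if_neg hcb, if_neg h]
    exact ℓ.weightBound_nonneg _ _ _ _

/-- Families that consist of a length and a nonzero family of bounded weights on the states.
The lengths add up; the weights of a composite are those of its first factor. -/
def weightLaw : FamilyLaw Y.State (Option Y.State) where
  carrier a b := {q | (Y.Reaches a b ∧ ℓ.dist a b ≤ q none) ∧
    (∀ c, 0 ≤ q (some c) ∧ q (some c) ≤ ℓ.weightBound a b c (q none)) ∧ ∃ c, 0 < q (some c)}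
  mul q r i := i.elim (q none + r none) fun c => q (some c)
  continuous_mul := continuous_pi fun
    | none => ((continuous_apply none).comp continuous_fst).add
        ((continuous_apply none).comp continuous_snd)
    | some c => (continuous_apply (some c)).comp continuous_fst
  mul_assoc q r s := by
    funext i
    cases i with
    | none => exact add_assoc _ _ _
    | some c => rfl
  mul_mem hq hr :=
    ⟨⟨hq.1.1.trans hr.1.1, (ℓ.dist_triangle hq.1.1 hr.1.1).trans (add_le_add hq.1.2 hr.1.2)⟩,
      fun e => ⟨(hq.2.1 e).1, (hq.2.1 e).2.trans
        (ℓ.weightBound_le_add e hq.1.1 hr.1.1 hq.1.2 hr.1.2)⟩, hq.2.2⟩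

-- For a given length, the admissible weights form a box without its origin, whose side at `b` is
-- always `[0, 1]`. Each weight is extended separately by Tietze and clipped to the box; a bump in
-- direction `b` avoids the origin inside the disk.
open Classical in
theorem isFibration_weightLaw :
    FamilyLaw.IsFibration ℓ.weightLaw ℓ.lengthLaw fun _ => none where
  mem hq := hq.1
  mul _ _ := rfl
  lift a b n f g hf hg hfm hgm hfg := by
    choose l hl hlf using fun c : Y.State =>
      exists_extension_disk n ((continuous_apply (some c)).comp hf)
    let ρ : TopCat.disk.{u} n → ℝ := fun x => 1 - ‖x.down.1‖
    have hρ : Continuous ρ := continuous_const.sub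
      (continuous_norm.comp (continuous_subtype_val.comp continuous_uliftDown))
    have hρ0 : ∀ s, ρ ((TopCat.diskBoundaryInclusion.{u} n).hom s) = 0 := fun s =>
      sub_eq_zero.2 (mem_sphere_zero_iff_norm.1 s.down.2).symm
    have hρpos : ∀ x, (∃ s, (TopCat.diskBoundaryInclusion.{u} n).hom s = x) ∨ 0 < ρ x := by
      intro x
      have hx : ‖x.down.1‖ ≤ 1 := mem_closedBall_zero_iff.1 x.down.2
      rcases hx.eq_or_lt with hx | hx
      · exact .inl ⟨⟨⟨x.down.1, mem_sphere_zero_iff_norm.2 hx⟩⟩, rfl⟩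
      · exact .inr (sub_pos.2 hx)
    -- The bump `ρ` is zero on the sphere and positive inside, so the boundary values are unchanged.
    let w : TopCat.disk.{u} n → Y.State → ℝ := fun x c =>
      min (max (max 0 (l c x)) (if c = b then ρ x else 0))
        (ℓ.weightBound a b c (g x PUnit.unit))
    have hgc : Continuous fun x => g x PUnit.unit := (continuous_apply _).comp hg
    have hw : ∀ c, Continuous fun x => w x c := by
      intro c
      refine ((continuous_const.max (hl c)).max ?_).min ((ℓ.continuous_weightBound a b c).comp hgc)
      split_ifs
      · exact hρ
      · exact continuous_const
    have hws : ∀ s c, w ((TopCat.diskBoundaryInclusion.{u} n).hom s) c = f s (some c) := by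
      intro s c
      have h1 := (hfm s).2.1 c
      have h2 : f s none = g ((TopCat.diskBoundaryInclusion.{u} n).hom s) PUnit.unit :=
        congrFun (hfg s) _
      have h3 : l c ((TopCat.diskBoundaryInclusion.{u} n).hom s) = f s (some c) := hlf c s
      simp only [w, hρ0, ite_self, h3, ← h2]
      rw [max_eq_right h1.1, max_eq_left h1.1, min_eq_left h1.2]
    have hl0 : ∀ s, (fun i : Option Y.State => i.elim
        (g ((TopCat.diskBoundaryInclusion.{u} n).hom s) PUnit.unit)
        (w ((TopCat.diskBoundaryInclusion.{u} n).hom s))) = f s := by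
      intro s
      funext i
      cases i with
      | none => exact (congrFun (hfg s) PUnit.unit).symm
      | some c => exact hws s c
    refine ⟨fun x i => i.elim (g x PUnit.unit) (w x), continuous_pi fun
      | none => hgc
      | some c => hw c, fun x => ?_, hl0, fun x => rfl⟩
    refine ⟨hgm x, fun c => ⟨?_, min_le_right _ _⟩, ?_⟩
    · exact le_min (le_max_of_le_left (le_max_left _ _)) (ℓ.weightBound_nonneg _ _ _ _)
    · rcases hρpos x with ⟨s, rfl⟩ | h
      · obtain ⟨c, hc⟩ := (hfm s).2.2
        exact ⟨c, by simpa only [Option.elim_some, hws] using hc⟩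
      · refine ⟨b, ?_⟩
        simp only [Option.elim_some, w, if_true, weightBound_self]
        exact lt_min (lt_max_of_lt_right h) one_pos

end Length

/-! ### Successors at states with a singleton branching space -/

/-- The quotient by the kernel of `φ` injects continuously into a Hausdorff space, so this kernel is
one of the relations whose infimum defines the branching space. -/
theorem eq_of_unique_branchingSpace {Y : PathFlow.{u}} {a : Y.State}
    (h : Nonempty (Unique (Y.BranchingSpace a))) {Z : Type u} [TopologicalSpace Z] [T2Space Z]
    {φ : (Σ b, Y.Path a b) → Z} (hφ : Continuous φ)
    (hcomp : ∀ (b c : Y.State) (x : Y.Path a b) (y : Y.Path b c),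
      φ ⟨b, x⟩ = φ ⟨c, Y.comp x y⟩) (x y : Σ b, Y.Path a b) : φ x = φ y := by
  obtain ⟨h⟩ := h
  have hxy : Y.branchingSetoid a x y := Quotient.exact (Subsingleton.elim (Quotient.mk _ x) _)
  have : T2Space (Quotient (Setoid.ker φ)) :=
    .of_injective_continuous (Setoid.kerLift_injective φ) (hφ.quotient_lift _)
  exact (sInf_le (a := Setoid.ker φ) ⟨hcomp, .of_t2⟩ : Y.branchingSetoid a ≤ _) hxy

theorem IsCofibrant.exists_successor {Y : PathFlow.{u}} (hY : Y.IsCofibrant) (ℓ : Y.Length)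
    {a : Y.State} (h : Nonempty (Unique (Y.BranchingSpace a))) :
    ∃ b, Y.Reaches a b ∧ ∀ c (x : Y.Path a c),
      b = c ∨ ∃ z : Y.Path b c, ℓ.toFun z < ℓ.toFun x - 1 := by
  obtain ⟨ψ, hψ⟩ := ℓ.isFibration_weightLaw.exists_lift hY ℓ.rep
  have hconst := eq_of_unique_branchingSpace h
    (φ := fun x : Σ b, Y.Path a b => fun c => ψ.toFun x.2 (some c))
    (continuous_pi fun c => continuous_sigma fun b =>
      (continuous_apply (some c)).comp (ψ.continuous_toFun a b))
    (fun b c x y => funext fun e => (congrFun (ψ.map_comp x y) (some e)).symm)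
  obtain ⟨x₀, -⟩ := Quotient.exists_rep h.some.default
  -- Any state with positive weight on one path will do: by `hconst` its weight is positive on every
  -- path from `a`.
  obtain ⟨b, hb⟩ := (ψ.mem x₀.2).2.2
  have key : ∀ c (x : Y.Path a c),
      b = c ∨ Y.Reaches a b ∧ ∃ z : Y.Path b c, ℓ.toFun z < ℓ.toFun x - 1 := by
    intro c x
    refine ℓ.weightBound_pos (lt_of_lt_of_le hb ?_)
    have h1 := ((ψ.mem x).2.1 b).2
    have h2 : ψ.toFun x none = ℓ.toFun x := congrFun (hψ x) PUnit.unit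
    rw [h2] at h1
    exact (congrFun (hconst x₀ ⟨c, x⟩) b).trans_le h1
  refine ⟨b, ?_, fun c x => (key c x).imp_right And.right⟩
  rcases key x₀.1 x₀.2 with rfl | h
  · exact ⟨x₀.2⟩
  · exact h.1

/-- Pass to successors until `B` is met. Whatever is reachable from `a` is the successor or
reachable from it, so minimality is kept. The remaining length to a fixed element of `B` drops by
more than `1` each time, so the process stops. -/
theorem IsCofibrant.exists_least_above {Y : PathFlow.{u}} (hY : Y.IsCofibrant) {B : Set Y.State}
    (hu : ∀ a ∉ B, Nonempty (Unique (Y.BranchingSpace a))) {a : Y.State} (ha : a ∉ B)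
    (hB : ∃ c ∈ B, Y.Reaches a c) :
    ∃ b ∈ B, Y.Reaches a b ∧ ∀ c ∈ B, Y.Reaches a c → b = c ∨ Y.Reaches b c := by
  obtain ⟨ℓ⟩ := hY.nonempty_length
  obtain ⟨c, hc, ⟨x⟩⟩ := hB
  obtain ⟨k, hk⟩ := exists_nat_gt (ℓ.toFun x)
  induction k generalizing a with
  | zero => exact absurd hk (by have := ℓ.two_le x; push_cast; linarith)
  | succ k ih =>
    obtain ⟨s, has, hs⟩ := hY.exists_successor ℓ (hu a ha)
    have hs' : ∀ e, Y.Reaches a e → s = e ∨ Y.Reaches s e := fun e ⟨y⟩ =>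
      (hs e y).imp_right fun ⟨z, _⟩ => ⟨z⟩
    by_cases hsB : s ∈ B
    · exact ⟨s, hsB, has, fun e _ he => hs' e he⟩
    · rcases hs c x with rfl | ⟨z, hz⟩
      · exact absurd hc hsB
      · obtain ⟨b, hb, hsb, hmin⟩ := ih hsB z (by push_cast at hk; linarith)
        refine ⟨b, hb, has.trans hsb, fun e he hae => ?_⟩
        rcases hs' e hae with rfl | hse
        · exact absurd he hsB
        · exact hmin e he hse

/-! ### Cores of flows -/

/-- The map `e` identifies the relation `r` with the existence of paths between the states in its
image, and every other state has a first state of the image above it and a last one below it. -/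
structure IsCore (X : PathFlow.{u}) {K : Type u} (r : K → K → Prop) (e : K → X.State) : Prop where
  injective : Function.Injective e
  reaches_iff : ∀ i j, X.Reaches (e i) (e j) ↔ r i j
  above : ∀ x ∉ Set.range e, ∃ k, X.Reaches x (e k) ∧ ∀ k', X.Reaches x (e k') → k = k' ∨ r k k'
  below : ∀ x ∉ Set.range e, ∃ k, X.Reaches (e k) x ∧ ∀ k', X.Reaches (e k') x → k = k' ∨ r k' k

/-- The relation `r` has no element with both a first element above it and a last element
below it. -/
def IsRigid {K : Type u} (r : K → K → Prop) : Prop :=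
  ∀ k, (∃ s, r k s ∧ ∀ t, r k t → s = t ∨ r s t) →
    ¬ ∃ s, r s k ∧ ∀ t, r t k → s = t ∨ r t s

variable {X Y : PathFlow.{u}} {K : Type u} {r : K → K → Prop}

/-- `f` is injective on states, and preserves and reflects the existence of paths. -/
structure IsStateEmbedding (f : X.State → Y.State) : Prop where
  injective : Function.Injective f
  reaches_iff : ∀ a b, Y.Reaches (f a) (f b) ↔ X.Reaches a b

theorem IsCore.op {e : K → X.State} (h : X.IsCore r e) :
    X.op.IsCore (fun i j => r j i) e :=
  ⟨h.injective, fun i j => h.reaches_iff j i, h.below, h.above⟩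

theorem IsStateEmbedding.isCore_comp_iff {f : X.State → Y.State} (hf : IsStateEmbedding f)
    (hsurj : Function.Surjective f) {e : K → X.State} : Y.IsCore r (f ∘ e) ↔ X.IsCore r e := by
  have hr : ∀ x, f x ∉ Set.range (f ∘ e) ↔ x ∉ Set.range e := fun x =>
    not_congr ⟨fun ⟨k, hk⟩ => ⟨k, hf.injective hk⟩, fun ⟨k, hk⟩ => ⟨k, congrArg f hk⟩⟩
  constructor
  · intro h
    refine ⟨h.injective.of_comp, fun i j => (hf.reaches_iff _ _).symm.trans (h.reaches_iff i j),
      fun x hx => ?_, fun x hx => ?_⟩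
    · simpa only [Function.comp_apply, hf.reaches_iff] using h.above (f x) ((hr x).2 hx)
    · simpa only [Function.comp_apply, hf.reaches_iff] using h.below (f x) ((hr x).2 hx)
  · intro h
    refine ⟨hf.injective.comp h.injective,
      fun i j => (hf.reaches_iff _ _).trans (h.reaches_iff i j), fun y hy => ?_, fun y hy => ?_⟩
    · obtain ⟨x, rfl⟩ := hsurj y
      simpa only [Function.comp_apply, hf.reaches_iff] using h.above x ((hr x).1 hy)
    · obtain ⟨x, rfl⟩ := hsurj y
      simpa only [Function.comp_apply, hf.reaches_iff] using h.below x ((hr x).1 hy)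

/-! ### Invariance under S-homotopy equivalences -/

theorem SHomotopic.state_eq {f g : X ⟶ Y} (h : SHomotopic f g) (a : X.State) :
    Hom.state f a = Hom.state g a := by
  obtain ⟨H, -, rfl, hs, -⟩ := h
  exact (hs 1 a).symm

theorem IsSHomotopyEquiv.bijective {f : X ⟶ Y} (h : IsSHomotopyEquiv f) :
    Function.Bijective (Hom.state f) := by
  obtain ⟨g, h1, h2⟩ := h
  exact Function.bijective_iff_has_inverse.2 ⟨Hom.state g, h1.state_eq, h2.state_eq⟩

theorem IsSHomotopyEquiv.isStateEmbedding {f : X ⟶ Y} (h : IsSHomotopyEquiv f) :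
    IsStateEmbedding (X := X) (Y := Y) (Hom.state f) := by
  refine ⟨h.bijective.1, fun a b => ⟨fun ⟨y⟩ => ?_, fun ⟨x⟩ => ⟨Hom.path f x⟩⟩⟩
  obtain ⟨g, h1, h2⟩ := h
  have h3 : X.Reaches (Hom.state g (Hom.state f a)) (Hom.state g (Hom.state f b)) :=
    ⟨Hom.path g y⟩
  have ha : Hom.state g (Hom.state f a) = a := h1.state_eq a
  have hb : Hom.state g (Hom.state f b) = b := h1.state_eq b
  rwa [ha, hb] at h3

theorem IsSHomotopyEquiv.exists_isCore_iff {f : X ⟶ Y} (h : IsSHomotopyEquiv f) :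
    (∃ e, X.IsCore r e) ↔ ∃ e, Y.IsCore r e := by
  have hf := h.isStateEmbedding
  have hs := h.bijective.2
  constructor
  · rintro ⟨e, he⟩
    exact ⟨_, (hf.isCore_comp_iff hs).2 he⟩
  · rintro ⟨e, he⟩
    choose g hg using hs
    refine ⟨g ∘ e, (hf.isCore_comp_iff h.bijective.2).1 ?_⟩
    have : Hom.state f ∘ g ∘ e = e := funext fun k => hg (e k)
    rwa [this]

/-- Each summand of a disjoint union is clopen, so a continuous path cannot leave it. -/
theorem index_eq_of_joined {ι : Type*} {A : ι → Type*} [∀ i, TopologicalSpace (A i)]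
    {x y : Σ i, A i} (h : Joined x y) : x.1 = y.1 := by
  obtain ⟨γ⟩ := h
  have hx : x ∈ Set.range (Sigma.mk x.1 : A x.1 → Σ i, A i) := ⟨x.2, rfl⟩
  have hc : IsClopen (Set.range (Sigma.mk x.1 : A x.1 → Σ i, A i)) :=
    ⟨Topology.IsClosedEmbedding.sigmaMk.isClosed_range,
      Topology.IsOpenEmbedding.sigmaMk.isOpen_range⟩
  have := (isPreconnected_range γ.continuous).subset_isClopen hc
    ⟨x, ⟨0, γ.source⟩, hx⟩ ⟨1, γ.target⟩
  obtain ⟨z, rfl⟩ := this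
  rfl

/-- Only surjectivity on path components is needed: the component of a path of `Y` comes from a path
of `X`, whose endpoints are forced by injectivity on states. -/
theorem IsWeakSHomotopyEquiv.isStateEmbedding {f : X ⟶ Y} (h : IsWeakSHomotopyEquiv f) :
    IsStateEmbedding (X := X) (Y := Y) (Hom.state f) := by
  refine ⟨h.1.1, fun a b => ⟨fun ⟨y⟩ => ?_, fun ⟨x⟩ => ⟨Hom.path f x⟩⟩⟩
  obtain ⟨q, hq⟩ := h.2.1.2 (Quotient.mk _ ⟨(Hom.state f a, Hom.state f b), y⟩)
  obtain ⟨x, rfl⟩ := Quotient.exists_rep q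
  have hj : Joined (Hom.onPaths f x) ⟨(Hom.state f a, Hom.state f b), y⟩ := Quotient.exact hq
  have hi := index_eq_of_joined hj
  have h1 : x.1.1 = a := h.1.1 (congrArg Prod.fst hi)
  have h2 : x.1.2 = b := h.1.1 (congrArg Prod.snd hi)
  exact h1 ▸ h2 ▸ ⟨x.2⟩

/-! ### Invariance under T-homotopy equivalences -/

theorem IsTHomotopyEquiv.isStateEmbedding {f : X ⟶ Y} (h : IsTHomotopyEquiv f) :
    IsStateEmbedding (X := X) (Y := Y) (Hom.state f) := by
  obtain ⟨g, hg, -⟩ := h.isIso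
  have hga : ∀ a, Hom.state g (Hom.state (Hom.toRestrict f) a) = a :=
    congrFun (congrArg (fun k => Hom.state k) hg)
  refine ⟨fun a b hab => ?_, fun a b => ⟨fun ⟨y⟩ => ?_, fun ⟨x⟩ => ⟨Hom.path f x⟩⟩⟩
  · rw [← hga a, ← hga b]
    exact congrArg _ (Subtype.ext hab)
  · have h3 : X.Reaches (Hom.state g (Hom.state (Hom.toRestrict f) a))
        (Hom.state g (Hom.state (Hom.toRestrict f) b)) :=
      ⟨Hom.path g (a := Hom.state (Hom.toRestrict f) a) (b := Hom.state (Hom.toRestrict f) b) y⟩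
    rwa [hga, hga] at h3

/-- The first core state above a new state is found from the least old state above it. Applied to
reversed flows, the same statement gives the condition from below. -/
theorem IsCore.above_comp {f : X.State → Y.State} (hf : IsStateEmbedding f) {e : K → X.State}
    (he : X.IsCore r e)
    (hB : ∀ a ∉ Set.range f, ∃ b ∈ Set.range f, Y.Reaches a b ∧
      ∀ c ∈ Set.range f, Y.Reaches a c → b = c ∨ Y.Reaches b c) (y : Y.State)
    (hy : y ∉ Set.range (f ∘ e)) :
    ∃ k, Y.Reaches y (f (e k)) ∧ ∀ k', Y.Reaches y (f (e k')) → k = k' ∨ r k k' := by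
  have key : ∀ x, x ∉ Set.range e →
      ∃ k, Y.Reaches (f x) (f (e k)) ∧ ∀ k', Y.Reaches (f x) (f (e k')) → k = k' ∨ r k k' := by
    intro x hx
    simpa only [hf.reaches_iff] using he.above x hx
  by_cases hyf : y ∈ Set.range f
  · obtain ⟨x, rfl⟩ := hyf
    exact key x fun ⟨k, hk⟩ => hy ⟨k, congrArg f hk⟩
  · obtain ⟨_, ⟨x, rfl⟩, hyx, hmin⟩ := hB y hyf
    by_cases hx : x ∈ Set.range e
    · obtain ⟨k, rfl⟩ := hx
      refine ⟨k, hyx, fun k' hk' => ?_⟩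
      exact (hmin _ ⟨_, rfl⟩ hk').imp (fun h => he.injective (hf.injective h))
        fun h => (he.reaches_iff _ _).1 ((hf.reaches_iff _ _).1 h)
    · obtain ⟨k, hk, hk'⟩ := key x hx
      refine ⟨k, hyx.trans hk, fun k' h => ?_⟩
      rcases hmin _ ⟨_, rfl⟩ h with h | h
      · exact absurd ⟨k', (hf.injective h).symm⟩ hx
      · exact hk' k' h

theorem IsStateEmbedding.op {f : X.State → Y.State} (hf : IsStateEmbedding f) :
    IsStateEmbedding (X := X.op) (Y := Y.op) f :=
  ⟨hf.injective, fun a b => hf.reaches_iff b a⟩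

theorem IsTHomotopyEquiv.isCore_comp {f : X ⟶ Y} (h : IsTHomotopyEquiv f) (hY : Y.IsCofibrant)
    {e : K → X.State} (he : X.IsCore r e) : Y.IsCore r (Hom.state f ∘ e) := by
  have hf := h.isStateEmbedding
  refine ⟨hf.injective.comp he.injective,
    fun i j => (hf.reaches_iff _ _).trans (he.reaches_iff i j), ?_, ?_⟩
  · exact he.above_comp hf fun a ha => hY.exists_least_above h.branching ha
      ((h.surrounded a trivial).resolve_left ha).2
  · exact he.op.above_comp hf.op fun a ha => hY.op.exists_least_above h.merging ha
      ((h.surrounded a trivial).resolve_left ha).1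

/-- If the successor of `e k` is in the core it is the answer; if not, the first core state above it
is. -/
theorem IsCofibrant.exists_least_above_core (hY : Y.IsCofibrant) {e : K → Y.State}
    (he : Y.IsCore r e) {k : K} (hk : Nonempty (Unique (Y.BranchingSpace (e k)))) :
    ∃ s, r k s ∧ ∀ t, r k t → s = t ∨ r s t := by
  obtain ⟨ℓ⟩ := hY.nonempty_length
  obtain ⟨b, hb, hmin⟩ := hY.exists_successor ℓ hk
  have hmin' : ∀ t, r k t → b = e t ∨ Y.Reaches b (e t) := fun t ht => by
    obtain ⟨x⟩ := (he.reaches_iff k t).2 ht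
    exact (hmin _ x).imp_right fun ⟨z, _⟩ => ⟨z⟩
  by_cases hbe : b ∈ Set.range e
  · obtain ⟨s, rfl⟩ := hbe
    exact ⟨s, (he.reaches_iff _ _).1 hb, fun t ht =>
      (hmin' t ht).imp (fun h => he.injective h) (he.reaches_iff _ _).1⟩
  · obtain ⟨s, hs, hs'⟩ := he.above b hbe
    refine ⟨s, (he.reaches_iff _ _).1 (hb.trans hs), fun t ht => ?_⟩
    rcases hmin' t ht with h | h
    · exact absurd ⟨t, h.symm⟩ hbe
    · exact hs' t h

theorem IsTHomotopyEquiv.exists_isCore {f : X ⟶ Y} (h : IsTHomotopyEquiv f) (hY : Y.IsCofibrant)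
    (hr : IsRigid r) {e : K → Y.State} (he : Y.IsCore r e) : ∃ e', X.IsCore r e' := by
  have hf := h.isStateEmbedding
  have hsub : ∀ k, ∃ x, Hom.state f x = e k := by
    intro k
    by_contra hk
    -- A core state missed by `f` has singleton branching and merging spaces, against rigidity.
    exact hr k (hY.exists_least_above_core he (h.branching _ hk))
      (hY.op.exists_least_above_core he.op (h.merging _ hk))
  choose e' he' using hsub
  have hx : ∀ x, x ∉ Set.range e' → Hom.state f x ∉ Set.range e := fun x hx ⟨k, hk⟩ =>
    hx ⟨k, hf.injective ((he' k).trans hk)⟩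
  have hr1 : ∀ x k, X.Reaches x (e' k) ↔ Y.Reaches (Hom.state f x) (e k) := fun x k => by
    rw [← hf.reaches_iff, he']
  have hr2 : ∀ x k, X.Reaches (e' k) x ↔ Y.Reaches (e k) (Hom.state f x) := fun x k => by
    rw [← hf.reaches_iff, he']
  refine ⟨e', fun i j hij => he.injective ?_, fun i j => ?_, fun x h' => ?_, fun x h' => ?_⟩
  · rw [← he', ← he', hij]
  · rw [hr1, he', he.reaches_iff]
  · simpa only [hr1] using he.above _ (hx x h')
  · simpa only [hr2] using he.below _ (hx x h')

theorem exists_isCore_iff (hr : IsRigid r) (hY : Y.IsCell) {f : X ⟶ Y}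
    (h : IsSHomotopyEquiv f ∨ IsTHomotopyEquiv f) :
    (∃ e, X.IsCore r e) ↔ ∃ e, Y.IsCore r e := by
  rcases h with h | h
  · exact h.exists_isCore_iff
  · exact ⟨fun ⟨_, he⟩ => ⟨_, h.isCore_comp hY.isCofibrant he⟩,
      fun ⟨_, he⟩ => h.exists_isCore hY.isCofibrant hr he⟩

/-! ### The states of the cube -/

theorem segment_reaches_iff {s t : GlobState.{u}} :
    segment.{u}.Reaches s t ↔ s = .bot ∧ t = .top := by
  cases s <;> cases t <;> constructor
  all_goals first
    | exact fun ⟨x⟩ => PEmpty.elim x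
    | exact fun _ => ⟨rfl, rfl⟩
    | exact fun _ => ⟨PUnit.unit⟩
    | simp

theorem tensor_reaches_iff {a c : X.State} {b d : Y.State} :
    (tensor X Y).Reaches (a, b) (c, d) ↔
      X.Reaches a c ∧ Y.Reaches b d ∨ a = c ∧ Y.Reaches b d ∨ b = d ∧ X.Reaches a c := by
  constructor
  · rintro ⟨x | ⟨⟨h⟩, x⟩ | ⟨⟨h⟩, x⟩⟩
    · exact .inl ⟨⟨x.fst⟩, ⟨x.snd⟩⟩
    · exact .inr (.inl ⟨h, ⟨x⟩⟩)
    · exact .inr (.inr ⟨h, ⟨x⟩⟩)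
  · rintro (⟨⟨x⟩, ⟨y⟩⟩ | ⟨h, ⟨x⟩⟩ | ⟨h, ⟨x⟩⟩)
    · exact ⟨.inl ⟨x, y⟩⟩
    · exact ⟨.inr (.inl ⟨⟨h⟩, x⟩)⟩
    · exact ⟨.inr (.inr ⟨⟨h⟩, x⟩)⟩

/-- The set of coordinates at which a vertex of the cube is at the top state. -/
def vertexSupport : ∀ n, (segmentPow.{u} n).State → Finset ℕ
  | 0, _ => ∅
  | n + 1, (a, .bot) => vertexSupport n a
  | n + 1, (a, .top) => insert n (vertexSupport n a)

theorem vertexSupport_subset : ∀ n (a : (segmentPow.{u} n).State),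
    vertexSupport n a ⊆ Finset.range n
  | 0, _ => Finset.empty_subset _
  | n + 1, (a, .bot) => (vertexSupport_subset n a).trans (Finset.range_subset_range.2 n.le_succ)
  | n + 1, (a, .top) => Finset.insert_subset (Finset.self_mem_range_succ n)
      ((vertexSupport_subset n a).trans (Finset.range_subset_range.2 n.le_succ))

theorem notMem_vertexSupport (n : ℕ) (a : (segmentPow.{u} n).State) : n ∉ vertexSupport n a :=
  fun h => Finset.notMem_range_self (vertexSupport_subset n a h)

theorem vertexSupport_injective : ∀ n, Function.Injective (vertexSupport.{u} n)
  | 0, _, _, _ => rfl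
  | n + 1, (a, s), (b, t), h => by
    have ha := notMem_vertexSupport n a
    have hb := notMem_vertexSupport n b
    cases s <;> cases t <;> simp only [vertexSupport] at h
    · rw [vertexSupport_injective n h]
    · exact absurd (h ▸ Finset.mem_insert_self _ _) ha
    · exact absurd (h ▸ Finset.mem_insert_self _ _) hb
    · have := congrArg (fun s => Finset.erase s n) h
      simp only [Finset.erase_insert ha, Finset.erase_insert hb] at this
      rw [vertexSupport_injective n this]

theorem exists_vertexSupport_eq : ∀ n (s : Finset ℕ), s ⊆ Finset.range n →
    ∃ a : (segmentPow.{u} n).State, vertexSupport n a = s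
  | 0, s, hs => ⟨PUnit.unit, (Finset.subset_empty.1 hs).symm⟩
  | n + 1, s, hs => by
    have : s.erase n ⊆ Finset.range n := by
      intro i hi
      have h1 := Finset.mem_range.1 (hs (Finset.mem_of_mem_erase hi))
      have h2 := Finset.ne_of_mem_erase hi
      exact Finset.mem_range.2 (by omega)
    obtain ⟨a, ha⟩ := exists_vertexSupport_eq n _ this
    by_cases hn : n ∈ s
    · exact ⟨(a, .top), by rw [vertexSupport, ha, Finset.insert_erase hn]⟩
    · exact ⟨(a, .bot), by rw [vertexSupport, ha, Finset.erase_eq_of_notMem hn]⟩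

theorem segmentPow_reaches_iff : ∀ n (a b : (segmentPow.{u} n).State),
    (segmentPow n).Reaches a b ↔ vertexSupport n a ⊂ vertexSupport n b
  | 0, _, _ => ⟨fun ⟨x⟩ => PEmpty.elim x, fun h => absurd h (ssubset_irrefl _)⟩
  | n + 1, (a, s), (b, t) => by
    have ha := notMem_vertexSupport n a
    have hb := notMem_vertexSupport n b
    have hinj : a = b ↔ vertexSupport n a = vertexSupport n b :=
      (vertexSupport_injective n).eq_iff.symm
    have hst : segment.Reaches s t ↔ s = .bot ∧ t = .top := segment_reaches_iff
    refine tensor_reaches_iff.trans ?_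
    rw [segmentPow_reaches_iff n a b, hst, hinj]
    cases s <;> cases t <;> simp only [vertexSupport]
    · simp
      exact fun _ => rfl
    · have hne : vertexSupport n a ≠ insert n (vertexSupport n b) :=
        fun h => ha (h ▸ Finset.mem_insert_self _ _)
      rw [Finset.ssubset_iff_subset_ne, Finset.ssubset_iff_subset_ne,
        Finset.subset_insert_iff_of_notMem ha]
      constructor
      · rintro (h | h | h)
        · exact ⟨h.1.1, hne⟩
        · exact ⟨h.1.subset, hne⟩
        · exact ⟨h.2.1, hne⟩
      · rintro ⟨h, -⟩
        -- With equal supports only the last coordinate moves; otherwise both factors move.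
        by_cases he : vertexSupport n a = vertexSupport n b
        · exact .inr (.inl ⟨he, rfl, rfl⟩)
        · exact .inl ⟨⟨h, he⟩, rfl, rfl⟩
    · have : ¬ insert n (vertexSupport n a) ⊂ vertexSupport n b :=
        fun h => hb (h.1 (Finset.mem_insert_self _ _))
      simp [this]
    · have : insert n (vertexSupport n a) ⊂ insert n (vertexSupport n b) ↔
          vertexSupport n a ⊂ vertexSupport n b := by
        rw [Finset.ssubset_def, Finset.ssubset_def, Finset.insert_subset_insert_iff ha,
          Finset.insert_subset_insert_iff hb]
      simp [this]
      exact fun _ => rfl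

/-! ### Rigidity of the cube and the conclusion -/

theorem isRigid_segmentPow {n : ℕ} (hn : 3 ≤ n) : IsRigid (segmentPow.{u} n).Reaches := by
  rintro k ⟨s, hs, hs'⟩ ⟨p, hp, hp'⟩
  simp only [segmentPow_reaches_iff] at hs hs' hp hp'
  have hsub := vertexSupport_subset n k
  have hcard := Finset.card_sdiff_add_card_eq_card hsub
  rw [Finset.card_range] at hcard
  -- Of three or more coordinates, at least two are at the bottom or at least two are at the top.
  rcases (by omega : 1 < (Finset.range n \ vertexSupport n k).card ∨
    1 < (vertexSupport n k).card) with h | h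
  · obtain ⟨i, hi, j, hj, hij⟩ := Finset.one_lt_card.1 h
    rw [Finset.mem_sdiff] at hi hj
    have key : ∀ i, i ∈ Finset.range n → i ∉ vertexSupport n k →
        vertexSupport n s ⊆ insert i (vertexSupport n k) := by
      intro i hi hik
      obtain ⟨t, ht⟩ := exists_vertexSupport_eq.{u} n _ (Finset.insert_subset hi hsub)
      rw [← ht]
      rcases hs' t (ht ▸ Finset.ssubset_insert hik) with rfl | h
      · exact subset_rfl
      · exact h.subset
    -- The least vertex `s` lies below the vertices obtained by raising `i` or `j` alone, whose
    -- supports meet in that of `k`; this contradicts strictness.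
    refine hs.2 fun x hx => ?_
    have h1 := Finset.mem_insert.1 (key i hi.1 hi.2 hx)
    have h2 := Finset.mem_insert.1 (key j hj.1 hj.2 hx)
    rcases h1 with rfl | h1
    · exact h2.resolve_left hij
    · exact h1
  · obtain ⟨i, hi, j, hj, hij⟩ := Finset.one_lt_card.1 h
    have key : ∀ i, i ∈ vertexSupport n k →
        (vertexSupport n k).erase i ⊆ vertexSupport n p := by
      intro i hik
      obtain ⟨t, ht⟩ := exists_vertexSupport_eq.{u} n _
        ((Finset.erase_subset i _).trans hsub)
      rw [← ht]
      rcases hp' t (ht ▸ Finset.erase_ssubset hik) with rfl | h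
      · exact subset_rfl
      · exact h.subset
    -- Dually, the supports with `i` or `j` removed have the whole support of `k` as union.
    refine hp.2 fun x hx => ?_
    by_cases hxi : x = i
    · exact key j hj (Finset.mem_erase.2 ⟨hxi ▸ hij, hx⟩)
    · exact key i hi (Finset.mem_erase.2 ⟨hxi, hx⟩)

theorem not_isCore_segment {n : ℕ} (hn : 3 ≤ n)
    {e : (segmentPow.{u} n).State → segment.{u}.State} :
    ¬ segment.IsCore (segmentPow n).Reaches e := by
  intro he
  -- Three distinct vertices, the singletons, cannot inject into two states.
  choose v hv using fun i : Fin 3 => exists_vertexSupport_eq.{u} n {i.1}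
    (Finset.singleton_subset_iff.2 (Finset.mem_range.2 (i.2.trans_le hn)))
  have hvi : Function.Injective v := fun i j hij => by
    have := (hv i).symm.trans (hij ▸ hv j)
    exact Fin.ext (Finset.singleton_injective this)
  let τ : GlobState.{u} → Bool := fun s => match s with
    | .bot => false
    | .top => true
  have hτ : Function.Injective τ := by
    rintro (_ | _) (_ | _) h
    all_goals first | rfl | exact absurd h (by simp [τ])
  have := Fintype.card_le_of_injective _ (hτ.comp (he.injective.comp hvi))
  simp at this

end PathFlow

theorem mainTheorem1 (n : ℕ) (hn : 3 ≤ n) (C : PathFlow.{u})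
    (hC : C.IsCofibrantReplacement (PathFlow.segmentPow n)) :
    ¬ ∃ (m : ℕ) (X : ℕ → PathFlow.{u}), X 0 = C ∧ X (2 * m) = PathFlow.segment ∧
      (∀ i ≤ 2 * m, (X i).IsCell) ∧
      ∀ i < m,
        (∃ f : X (2 * i) ⟶ X (2 * i + 1),
          PathFlow.IsSHomotopyEquiv f ∨ PathFlow.IsTHomotopyEquiv f) ∧
        (∃ f : X (2 * i + 2) ⟶ X (2 * i + 1),
          PathFlow.IsSHomotopyEquiv f ∨ PathFlow.IsTHomotopyEquiv f) := by
  rintro ⟨m, X, h0, hm, hcell, hzig⟩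
  have hr := PathFlow.isRigid_segmentPow.{u} hn
  have hcore : ∀ i ≤ m, ∃ e, (X (2 * i)).IsCore (PathFlow.segmentPow.{u} n).Reaches e := by
    intro i
    induction i with
    | zero =>
      intro _
      obtain ⟨-, p, hp⟩ := hC
      have hbij := hp.1
      choose g hg using hp.1.2
      refine ⟨h0 ▸ g, ?_⟩
      subst h0
      refine (hp.isStateEmbedding.isCore_comp_iff hbij.2).1 ?_
      have hid : PathFlow.Hom.state p ∘ g = id := funext hg
      change PathFlow.IsCore _ _ (PathFlow.Hom.state p ∘ g)
      rw [hid]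
      exact ⟨Function.injective_id, fun _ _ => Iff.rfl, fun x hx => absurd ⟨x, rfl⟩ hx,
        fun x hx => absurd ⟨x, rfl⟩ hx⟩
    | succ i ih =>
      intro hi
      obtain ⟨⟨f, hf⟩, g, hg⟩ := hzig i hi
      -- Both arrows end at the odd stage, and only the target has to be cofibrant.
      have hc := hcell (2 * i + 1) (by omega)
      exact (PathFlow.exists_isCore_iff hr hc hg).2
        ((PathFlow.exists_isCore_iff hr hc hf).1 (ih (by omega)))
  have hlast := hcore m le_rfl
  rw [hm] at hlast
  obtain ⟨e, he⟩ := hlast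
  exact PathFlow.not_isCore_segment hn he
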